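/- Let $d \ge 3$. Conventions. $SL(2,\mathbb{C})$ is the group of spin isometries of hyperbolic space $\mathbb{H}^3$ (the double cover of $\mathrm{Isom}^+\mathbb{H}^3 = PSL(2,\mathbb{C})$), and a spin frame is a lift of a right-handed orthonormal frame of $\mathbb{H}^3$ to the double cover $\mathrm{Spin} \cong SL(2,\mathbb{C})$ of the frame bundle. A spin decoration on a horosphere is a pair $(W^{in}, W^{out})$ of continuous lifts to spin frames of the frame fields $(N^{in}, V, N^{in}\times V)$ and $(N^{out}, V, N^{out} \times V)$, where $V$ is a parallel unit tangent vector field, $N^{out}$ and $N^{in} = -N^{out}$ are the unit normals towards and away from the centre, and $W^{in}$ is obtained from $W^{out}$ by rotation through $\pi$ about $V$. The lambda length from one spin-decorated horosphere to another with a different centre is $\lambda = \exp(\frac12(\rho + i\theta))$, where translation through the signed distance $\rho$ along the oriented geodesic from the first centre to the second, followed by rotation through the angle $\theta$ (mod $4\pi$) about it, takes the first inward spin frame on this geodesic to the second outward spin frame on it. A nonzero spinor $\kappa = (\xi,\eta) \in \mathbb{C}^2$ corresponds to the horosphere in the upper half space model that is centred at $\xi/\eta$ and has Euclidean diameter $|\eta|^{-2}$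 (height $|\xi|^2$ if $\eta = 0$), with the spin decoration whose outward spin frames are the elements of $SL(2,\mathbb{C})$ that map $(1,0)$ to $\kappa$. Regard $\mathbb{H}^2$ as the half plane $y=0$ in the upper half space $\{(x,y,z) : z>0\}$, with boundary $\mathbb{R}\cup\{\infty\}$. An ideal $d$-gon is a sequence $p_1,\dots,p_d$ of distinct points of $\mathbb{R}\cup\{\infty\}$ in cyclic order for the decreasing orientation of $\mathbb{R}$. A planar spin decoration on a horocycle of $\mathbb{H}^2$ is a spin decoration on the horosphere of $\mathbb{H}^3$ extending it whose field $V$ is the unit vector in the positive $y$-direction along $\mathbb{H}^2$. A spin-coherent ideal $d$-gon is an ideal $d$-gon with a horocycle at each vertex and a planar spin decoration on each horocycle, such that the lambda lengths satisfy $\lambda_{ij}>0$ for $i<j$ and $\lambda_{ij}<0$ for $i>j$. Its spin isometry class is its orbit under $SL(2,\mathbb{R})$. The isometry class of an ideal $d$-gon decorated with a horocycle at each vertex consists of its images under isometries of $\mathbb{H}^2$ (as labelled polygons). The set of these classes is Penner's decorated Teichmüller space of a disc with $d$ boundary punctures. Then: 1. Sending a $2\times d$ real matrix, all of whose $2\times2$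 submatrices (columns $i<j$) have positive determinant, to the spin-decorated horospheres that correspond to its columns is an $SL(2,\mathbb{R})$-equivariant bijection onto the set of spin-coherent ideal $d$-gons. Hence it induces a bijection from the set of $SL(2,\mathbb{R})$-orbits of such matrices to the set of spin isometry classes of spin-coherent ideal $d$-gons. 2. Forgetting the spin decorations induces a bijection from the set of spin isometry classes of spin-coherent ideal $d$-gons to the set of isometry classes of ideal $d$-gons in $\mathbb{H}^2$ decorated with a horocycle at each vertex. 3. Consequently, sending a matrix to the decorated ideal $d$-gon underlying the spin-coherent ideal $d$-gon of its columns induces a bijection from $$SL(2,\mathbb{R}) \backslash \{\text{real } 2\times d \text{ matrices all of whose } 2\times 2 \text{ submatrices have positive determinant}\}$$ to the decorated Teichmüller space of a disc with $d$ boundary punctures. -/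

import Mathlib

open scoped ComplexOrder

noncomputable section

namespace SpinPolygon

/-! ### Hyperbolic 3-space: the hyperboloid model in Hermitian matrices

The point `(T, X, Y, Z)` of Minkowski space is written as the Hermitian matrix
`T • 1 + X • eX + Y • eY + Z • eZ`, so that the determinant is the quadratic form
`T ^ 2 - X ^ 2 - Y ^ 2 - Z ^ 2`. -/

/-- Complex `2 × 2` matrices. -/
abbrev Mat2 : Type := Matrix (Fin 2) (Fin 2) ℂ

/-- The group of spin isometries of hyperbolic 3-space. -/
abbrev SL2C : Type := Matrix.SpecialLinearGroup (Fin 2) ℂ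

/-- The group of spin isometries that preserve the hyperbolic plane. -/
abbrev SL2R : Type := Matrix.SpecialLinearGroup (Fin 2) ℝ

/-- The spin isometry of hyperbolic 3-space given by a real matrix. -/
def toSL2C : SL2R →* SL2C := Matrix.SpecialLinearGroup.map (algebraMap ℝ ℂ)

/-- The Minkowski inner product of two Hermitian matrices: the polarisation of the determinant. -/
@[irreducible]
def mink (X Y : Mat2) : ℝ := ((X * Y.adjugate).trace).re / 2

theorem mink_def (X Y : Mat2) : mink X Y = ((X * Y.adjugate).trace).re / 2 := by
  rw [mink]

/-- The linear action of a spin isometry on Hermitian matrices. -/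
def linAct (A : SL2C) (X : Mat2) : Mat2 := (A : Mat2) * X * (A : Mat2).conjTranspose

/-- Hyperbolic 3-space: positive definite Hermitian matrices of determinant 1, that is, the sheet
`T > 0` of the hyperboloid. -/
abbrev H3 : Type := {S : Mat2 // S.PosDef ∧ S.det = 1}

theorem linAct_one (X : Mat2) : linAct 1 X = X := by
  simp [linAct]

theorem linAct_mul (A B : SL2C) (X : Mat2) : linAct (A * B) X = linAct A (linAct B X) := by
  simp [linAct, Matrix.mul_assoc, Matrix.conjTranspose_mul]

theorem linAct_mem (A : SL2C) (S : H3) :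
    (linAct A S.1).PosDef ∧ (linAct A S.1).det = 1 := by
  refine ⟨?_, ?_⟩
  · have hA : IsUnit (A : Mat2) := by
      rw [Matrix.isUnit_iff_isUnit_det]; simp
    exact S.2.1.mul_mul_conjTranspose_same (Matrix.vecMul_injective_of_isUnit hA)
  · simp [linAct, Matrix.det_mul, Matrix.det_conjTranspose, S.2.2]

/-- Spin isometries act on hyperbolic 3-space by orientation-preserving isometries. -/
instance : MulAction SL2C H3 where
  smul A S := ⟨linAct A S.1, linAct_mem A S⟩
  one_smul S := Subtype.ext (linAct_one S.1)
  mul_smul A B S := Subtype.ext (linAct_mul A B S.1)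

theorem coe_smul (A : SL2C) (S : H3) : ((A • S : H3) : Mat2) = linAct A S.1 := rfl

theorem mink_linAct (A : SL2C) (X Y : Mat2) : mink (linAct A X) (linAct A Y) = mink X Y := by
  have h1 : (A : Mat2).adjugate * (A : Mat2) = 1 := by simp [Matrix.adjugate_mul]
  have h2 : (A : Mat2).conjTranspose * (A : Mat2).conjTranspose.adjugate = 1 := by
    simp [Matrix.mul_adjugate, Matrix.det_conjTranspose]
  have h3 : linAct A X * (linAct A Y).adjugate
      = (A : Mat2) * (X * Y.adjugate * (A : Mat2).adjugate) := by
    simp only [linAct, Matrix.adjugate_mul_distrib]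
    calc (A : Mat2) * X * (A : Mat2).conjTranspose *
          ((A : Mat2).conjTranspose.adjugate * (Y.adjugate * (A : Mat2).adjugate))
        = (A : Mat2) * X * ((A : Mat2).conjTranspose * (A : Mat2).conjTranspose.adjugate) *
            (Y.adjugate * (A : Mat2).adjugate) := by simp only [Matrix.mul_assoc]
      _ = (A : Mat2) * (X * Y.adjugate * (A : Mat2).adjugate) := by
          rw [h2]; simp only [Matrix.mul_assoc, Matrix.one_mul]
  have h4 : (linAct A X * (linAct A Y).adjugate).trace = (X * Y.adjugate).trace := by
    rw [h3, Matrix.trace_mul_comm, Matrix.mul_assoc, h1, Matrix.mul_one]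
  simp only [mink_def, h4]

/-! ### Frames and spin frames -/

/-- The base point `(0, 0, 1)` of the upper half space model. -/
def basePoint : H3 := ⟨1, Matrix.PosDef.one, Matrix.det_one⟩

/-- The unit tangent vector at the base point in the `x`-direction of the upper half space model.
Together, `eX, eY, eZ` form a right-handed frame. -/
def eX : Mat2 := !![0, 1; 1, 0]

/-- The unit tangent vector at the base point in the `y`-direction. -/
def eY : Mat2 := !![0, Complex.I; -Complex.I, 0]

/-- The unit tangent vector at the base point in the `z`-direction. -/
def eZ : Mat2 := !![1, 0; 0, -1]

/-- Spin frames. Orientation-preserving isometries act simply transitively on the right-handed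
orthonormal frames of hyperbolic 3-space, so that the frame bundle is `PSL(2, ℂ)`, through
`A ↦ A • (eZ, eY, -eX)`, and its double cover, the bundle of spin frames, is `SL(2, ℂ)`. The maps
`basepoint` and `frame` below are the projection to the frame bundle. Spin isometries act on spin
frames by left multiplication. -/
abbrev SpinFrame : Type := SL2C

/-- The point of hyperbolic 3-space at which a spin frame lies. -/
def SpinFrame.basepoint (W : SpinFrame) : H3 := W • basePoint

/-- The frame `(f₁, f₂, f₃)` that a spin frame lifts. -/
def SpinFrame.frame (W : SpinFrame) : Fin 3 → Mat2 :=
  ![linAct W eZ, linAct W eY, linAct W (-eX)]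

/-- Right multiplication by this matrix rotates each spin frame through the (right-handed) angle
`θ` about the second vector of its frame. -/
def rotSecond (θ : ℝ) : SL2C :=
  ⟨!![(Real.cos (θ / 2) : ℂ), -(Real.sin (θ / 2) : ℂ);
      (Real.sin (θ / 2) : ℂ), (Real.cos (θ / 2) : ℂ)], by
    rw [Matrix.det_fin_two_of]
    have h := Real.cos_sq_add_sin_sq (θ / 2)
    have h' : ((Real.cos (θ / 2) : ℂ)) ^ 2 + (Real.sin (θ / 2) : ℂ) ^ 2 = 1 := by exact_mod_cast h
    linear_combination h'⟩

/-- Right multiplication by this matrix translates each spin frame through the signed distance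
`d.re` along the geodesic directed by the first vector of its frame, and then rotates it through
the (right-handed) angle `d.im` about that geodesic. -/
def screwFirst (d : ℂ) : SL2C :=
  ⟨!![Complex.exp (d / 2), 0; 0, Complex.exp (-d / 2)], by
    rw [Matrix.det_fin_two_of, mul_zero, sub_zero, ← Complex.exp_add]
    rw [show d / 2 + -d / 2 = 0 by ring, Complex.exp_zero]⟩

/-- `d` is the complex distance from the spin frame `W₁` to the spin frame `W₂` (both are then
adapted to a common oriented geodesic). It is defined modulo `4πi`. -/
def IsComplexDistance (W₁ W₂ : SpinFrame) (d : ℂ) : Prop := W₂ = W₁ * screwFirst d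

/-! ### Horospheres and spin decorations -/

/-- The positive light cone: nonzero lightlike vectors that point to the future. -/
def lightCone : Set Mat2 := {n | n.IsHermitian ∧ n.det = 0 ∧ 0 < n.trace.re}

/-- The horosphere of a point `n` of the positive light cone. Its centre is the ray of `n`, and
this is a bijection between the positive light cone and the set of all horospheres. -/
def horosphere (n : Mat2) : Set H3 := {S | mink S.1 n = 1}

/-- `V` is a parallel field of unit tangent vectors on the horosphere of `n`: it is invariant under
the parabolic isometries that preserve the horosphere. -/
def IsParallelUnitField (n : Mat2) (V : horosphere n → Mat2) : Prop :=
  (∀ S, (V S).IsHermitian ∧ mink (V S) S.1.1 = 0 ∧ mink (V S) n = 0 ∧ mink (V S) (V S) = -1) ∧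
  ∀ A : SL2C, ((A : Mat2).trace = 2 ∨ (A : Mat2).trace = -2) →
    (∀ S : H3, A • S ∈ horosphere n ↔ S ∈ horosphere n) →
    ∀ S S' : horosphere n, (S' : H3) = A • (S : H3) → V S' = linAct A (V S)

/-- `W` is a continuous lift to spin frames of the outward frame field `(N, V, N × V)` on the
horosphere of `n`, where `N` is the unit normal field towards the centre, `N S = n - S`. (The
frames are right-handed, so the first two vectors determine the third.) -/
def IsOutwardSpinDecoration (n : Mat2) (V : horosphere n → Mat2) (W : horosphere n → SpinFrame) :
    Prop :=
  Continuous W ∧ ∀ S, SpinFrame.basepoint (W S) = S.1 ∧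
    SpinFrame.frame (W S) 0 = n - S.1.1 ∧ SpinFrame.frame (W S) 1 = V S

/-- `W` is a continuous lift to spin frames of the inward frame field `(N, V, N × V)` on the
horosphere of `n`, where `N` is the unit normal field away from the centre, `N S = S - n`. -/
def IsInwardSpinDecoration (n : Mat2) (V : horosphere n → Mat2) (W : horosphere n → SpinFrame) :
    Prop :=
  Continuous W ∧ ∀ S, SpinFrame.basepoint (W S) = S.1 ∧
    SpinFrame.frame (W S) 0 = S.1.1 - n ∧ SpinFrame.frame (W S) 1 = V S

/-- The pair `(Win, Wout)` is a spin decoration on the horosphere of `n`: the two lift the inward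
and outward frame fields of one parallel unit field `V`, and `Win` is obtained from `Wout` by
rotation through `π` about `V`. -/
def IsSpinDecoration (n : Mat2) (Win Wout : horosphere n → SpinFrame) : Prop :=
  (∃ V, IsParallelUnitField n V ∧ IsInwardSpinDecoration n V Win ∧
    IsOutwardSpinDecoration n V Wout) ∧
  ∀ S, Win S = Wout S * rotSecond Real.pi

/-- A spin-decorated horosphere: the horosphere of a point `normal` of the positive light cone, with
a spin decoration. -/
structure SpinDecoratedHorosphere where
  normal : Mat2
  normal_mem : normal ∈ lightCone
  inward : horosphere normal → SpinFrame
  outward : horosphere normal → SpinFrame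
  isSpinDecoration : IsSpinDecoration normal inward outward

/-- The spin isometry `A` maps the spin-decorated horosphere `D` to `D'`. -/
def Maps (A : SL2C) (D D' : SpinDecoratedHorosphere) : Prop :=
  D'.normal = linAct A D.normal ∧
  ∀ (S : horosphere D.normal) (S' : horosphere D'.normal), (S' : H3) = A • (S : H3) →
    D'.inward S' = A * D.inward S ∧ D'.outward S' = A * D.outward S

/-- `S` lies on the geodesic between the ideal points given by the rays of `n₁` and `n₂`. -/
def OnGeodesic (n₁ n₂ : Mat2) (S : H3) : Prop :=
  ∃ a b : ℝ, 0 < a ∧ 0 < b ∧ S.1 = a • n₁ + b • n₂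

/-- `d` is the complex distance from `D₁` to `D₂`: the one from the inward spin frame of `D₁` at
`q₁` to the outward spin frame of `D₂` at `q₂`, where `q₁` and `q₂` are the points where the
geodesic between the centres meets the two horospheres. There is none if the centres agree. -/
def IsHorosphereDistance (D₁ D₂ : SpinDecoratedHorosphere) (d : ℂ) : Prop :=
  ∃ (q₁ : horosphere D₁.normal) (q₂ : horosphere D₂.normal),
    OnGeodesic D₁.normal D₂.normal q₁ ∧ OnGeodesic D₁.normal D₂.normal q₂ ∧
    IsComplexDistance (D₁.inward q₁) (D₂.outward q₂) d

open Classical in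
/-- The complex lambda length `exp (d / 2)` from `D₁` to `D₂`, and `0` if the centres agree. -/
def lambdaLength (D₁ D₂ : SpinDecoratedHorosphere) : ℂ :=
  if h : ∃ d, IsHorosphereDistance D₁ D₂ d then Complex.exp (h.choose / 2) else 0

/-- The spin-decorated horosphere that corresponds to the spinor `κ`: the horosphere is that of the
point `2 κ κ*` of the light cone (so its centre is `κ 0 / κ 1`), and its outward spin frames are
the elements of `SL(2, ℂ)` that map the spinor `(1, 0)` to `κ`. -/
def CorrespondsTo (D : SpinDecoratedHorosphere) (κ : Fin 2 → ℂ) : Prop :=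
  D.normal = (2 : ℂ) • Matrix.vecMulVec κ (star κ) ∧
  ∀ S, (D.outward S : Mat2).mulVec ![1, 0] = κ

/-! ### The hyperbolic plane, its ideal polygons and horocycles -/

/-- The Hermitian matrix of a point of the hyperbolic plane in hyperbolic 3-space. The point `(z, t)` of the upper
half space model is the Hermitian matrix with rows `(‖z‖ ^ 2 + t ^ 2, z) / t` and
`(conj z, 1) / t`; the point `x + i y` of the upper half plane is the point `(x, y)` of the upper
half space. -/
def planeMatrix (z : UpperHalfPlane) : Mat2 :=
  ((z.im⁻¹ : ℝ) : ℂ) • !![((z.re ^ 2 + z.im ^ 2 : ℝ) : ℂ), (z.re : ℂ); (z.re : ℂ), 1]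

theorem planeMatrix_mem (z : UpperHalfPlane) :
    (planeMatrix z).PosDef ∧ (planeMatrix z).det = 1 := by
  have hy : 0 < z.im := z.im_pos
  have hyc : (z.im : ℂ) ≠ 0 := by exact_mod_cast hy.ne'
  refine ⟨?_, ?_⟩
  · have key : planeMatrix z = ((z.im⁻¹ : ℝ) : ℂ) •
        ((!![(z.im : ℂ), (z.re : ℂ); 0, 1] : Mat2) * 1 *
          (!![(z.im : ℂ), (z.re : ℂ); 0, 1] : Mat2).conjTranspose) := by
      ext i j
      rw [Matrix.mul_one]
      simp only [planeMatrix, Matrix.smul_apply]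
      congr 1
      rw [Matrix.mul_apply, Fin.sum_univ_two, Matrix.conjTranspose_apply,
        Matrix.conjTranspose_apply]
      fin_cases i <;> fin_cases j <;> simp
      ring
    have hB : IsUnit (!![(z.im : ℂ), (z.re : ℂ); 0, 1] : Mat2) := by
      rw [Matrix.isUnit_iff_isUnit_det, Matrix.det_fin_two_of]
      simpa using hy.ne'
    rw [key]
    refine Matrix.PosDef.smul ?_ ?_
    · exact Matrix.PosDef.one.mul_mul_conjTranspose_same (Matrix.vecMul_injective_of_isUnit hB)
    · rw [Complex.zero_lt_real]; exact inv_pos.mpr hy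
  · rw [planeMatrix, Matrix.det_smul, Matrix.det_fin_two_of]
    push_cast
    simp only [Fintype.card_fin]
    field_simp
    ring

/-- The inclusion of the hyperbolic plane in hyperbolic 3-space. -/
def plane (z : UpperHalfPlane) : H3 := ⟨planeMatrix z, planeMatrix_mem z⟩

/-- The horocycle in the upper half plane centred at `p ∈ ℝ ∪ {∞}`: the horizontal line at height
`r` if `p = ∞`, and the circle of Euclidean diameter `r` tangent to the real line at `p` if not. -/
def horocycle (p : OnePoint ℝ) (r : ℝ) : Set UpperHalfPlane :=
  OnePoint.rec {z | z.im = r} (fun x : ℝ => {z | (z.re - x) ^ 2 + z.im ^ 2 = r * z.im}) p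

/-- `c` is a horocycle centred at `p`. -/
def IsHorocycle (p : OnePoint ℝ) (c : Set UpperHalfPlane) : Prop :=
  ∃ r : ℝ, 0 < r ∧ c = horocycle p r

/-- Points of `ℝ ∪ {∞}` as elements of the linear order in which `∞` is the largest. -/
def height (p : OnePoint ℝ) : WithTop ℝ := OnePoint.rec ⊤ (fun x : ℝ => (x : WithTop ℝ)) p

/-- `a, b, c` are distinct and in cyclic order on `ℝ ∪ {∞}`, oriented in the negative direction. -/
def CyclicTriple (a b c : OnePoint ℝ) : Prop :=
  (height b < height a ∧ height c < height b) ∨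
  (height c < height b ∧ height a < height c) ∨
  (height a < height c ∧ height b < height a)

/-- `p` is a sequence of distinct points in (cyclic) order around `ℝ ∪ {∞}`, oriented in the
negative direction. -/
def InOrder {d : ℕ} (p : Fin d → OnePoint ℝ) : Prop :=
  Function.Injective p ∧ ∀ i j k : Fin d, i < j → j < k → CyclicTriple (p i) (p j) (p k)

/-- An ideal `d`-gon in the hyperbolic plane, decorated with a horocycle at each vertex. -/
structure DecoratedIdealGon (d : ℕ) where
  vertex : Fin d → OnePoint ℝ
  inOrder : InOrder vertex
  horocycle : Fin d → Set UpperHalfPlane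
  isHorocycle : ∀ i, IsHorocycle (vertex i) (horocycle i)

/-- The decoration of `D` is a planar spin decoration on the horocycle `c`: the horosphere of `D` is
the one that extends `c`, and the decoration is in the direction `i`, which is the direction of the
`y`-axis in the upper half space model. (The north pole lies in the hyperbolic plane if the centre
is in `ℝ`; at each point of the hyperbolic plane the unit vector in the `y`-direction is `eY`.) -/
def IsPlanarSpinDecoration (c : Set UpperHalfPlane) (D : SpinDecoratedHorosphere) : Prop :=
  plane ⁻¹' horosphere D.normal = c ∧
  ∀ (z : UpperHalfPlane) (hz : plane z ∈ horosphere D.normal),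
    SpinFrame.frame (D.inward ⟨plane z, hz⟩) 1 = eY ∧
    SpinFrame.frame (D.outward ⟨plane z, hz⟩) 1 = eY

/-- A spin-coherent ideal `d`-gon: an ideal `d`-gon with horocycles and planar spin decorations on
them, with lambda lengths `λ i j > 0` for `i < j` and `λ i j < 0` for `i > j`. -/
structure SpinCoherentGon (d : ℕ) extends DecoratedIdealGon d where
  decoration : Fin d → SpinDecoratedHorosphere
  planar : ∀ i, IsPlanarSpinDecoration (horocycle i) (decoration i)
  coherent_lt : ∀ i j, i < j → ∃ r : ℝ, 0 < r ∧ lambdaLength (decoration i) (decoration j) = r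
  coherent_gt : ∀ i j, j < i → ∃ r : ℝ, r < 0 ∧ lambdaLength (decoration i) (decoration j) = r

/-- Real `2 × d` matrices in which all `2 × 2` submatrices have positive determinant. -/
abbrev PositiveMatrix (d : ℕ) : Type :=
  {M : Matrix (Fin 2) (Fin d) ℝ // ∀ i j, i < j → 0 < (M.submatrix id ![i, j]).det}

/-- Column `i` of a real matrix, as a spinor. -/
def PositiveMatrix.spinor {d : ℕ} (M : PositiveMatrix d) (i : Fin d) : Fin 2 → ℂ :=
  fun k => (M.1 k i : ℂ)

/-! ### Isometry classes -/

/-- The isometry `φ` of the hyperbolic plane maps `P` to `Q`. (An isometry that maps a horocycle to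
a horocycle maps the centre to the centre.) -/
def MapsGon {d : ℕ} (φ : UpperHalfPlane ≃ᵢ UpperHalfPlane) (P Q : DecoratedIdealGon d) : Prop :=
  ∀ i, φ '' P.horocycle i = Q.horocycle i

/-- Two decorated ideal `d`-gons are equivalent if they are isometric. -/
instance isometrySetoid (d : ℕ) : Setoid (DecoratedIdealGon d) where
  r P Q := ∃ φ : UpperHalfPlane ≃ᵢ UpperHalfPlane, MapsGon φ P Q
  iseqv :=
    { refl := fun P => ⟨IsometryEquiv.refl _, fun i => by
        exact Set.image_id _⟩
      symm := by
        rintro P Q ⟨φ, h⟩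
        refine ⟨φ.symm, fun i => ?_⟩
        rw [← h i, ← Set.image_comp]
        simp
      trans := by
        rintro P Q R ⟨φ, h⟩ ⟨ψ, h'⟩
        refine ⟨φ.trans ψ, fun i => ?_⟩
        rw [← h' i, ← h i, ← Set.image_comp]
        rfl }

/-- Isometry classes of ideal `d`-gons in the hyperbolic plane, decorated with a horocycle at each
vertex: the decorated Teichmüller space of a disc with `d` boundary punctures. -/
abbrev IsometryClass (d : ℕ) : Type := Quotient (isometrySetoid d)

theorem Maps.one (D : SpinDecoratedHorosphere) : Maps 1 D D := by
  refine ⟨(linAct_one _).symm, fun S S' h => ?_⟩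
  have : S' = S := Subtype.ext (by simpa using h)
  subst this
  simp

theorem Maps.inv {A : SL2C} {D D' : SpinDecoratedHorosphere} (h : Maps A D D') :
    Maps A⁻¹ D' D := by
  refine ⟨?_, fun S' S hS => ?_⟩
  · rw [h.1, ← linAct_mul, inv_mul_cancel, linAct_one]
  · have h2 := h.2 S S' (by rw [hS, smul_inv_smul])
    rw [h2.1, h2.2, inv_mul_cancel_left, inv_mul_cancel_left]
    exact ⟨rfl, rfl⟩

theorem Maps.mul {A B : SL2C} {D D' D'' : SpinDecoratedHorosphere} (h : Maps A D D')
    (h' : Maps B D' D'') : Maps (B * A) D D'' := by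
  refine ⟨by rw [h'.1, h.1, linAct_mul], fun S S'' hS => ?_⟩
  have hm : A • (S : H3) ∈ horosphere D'.normal := by
    have hS1 : mink (S : H3).1 D.normal = 1 := S.2
    change mink (linAct A (S : H3).1) D'.normal = 1
    rw [h.1, mink_linAct, hS1]
  have h1 := h.2 S ⟨A • (S : H3), hm⟩ rfl
  have h2 := h'.2 ⟨A • (S : H3), hm⟩ S'' (by rw [hS, mul_smul])
  rw [h2.1, h2.2, h1.1, h1.2, mul_assoc, mul_assoc]
  exact ⟨rfl, rfl⟩

/-- The spin isometry `A` maps the spin-coherent ideal `d`-gon `X` to `Y`. -/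
def MapsSpinGon {d : ℕ} (A : SL2R) (X Y : SpinCoherentGon d) : Prop :=
  ∀ i, Maps (toSL2C A) (X.decoration i) (Y.decoration i)

/-- Two spin-coherent ideal `d`-gons are equivalent if they lie in one orbit of `SL(2, ℝ)`. -/
instance spinIsometrySetoid (d : ℕ) : Setoid (SpinCoherentGon d) where
  r X Y := ∃ A : SL2R, MapsSpinGon A X Y
  iseqv :=
    { refl := fun X => ⟨1, fun i => by rw [map_one]; exact Maps.one _⟩
      symm := by
        rintro X Y ⟨A, h⟩
        exact ⟨A⁻¹, fun i => by rw [map_inv]; exact (h i).inv⟩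
      trans := by
        rintro X Y Z ⟨A, h⟩ ⟨B, h'⟩
        exact ⟨B * A, fun i => by rw [map_mul]; exact (h i).mul (h' i)⟩ }

/-- Spin isometry classes of spin-coherent ideal `d`-gons. -/
abbrev SpinIsometryClass (d : ℕ) : Type := Quotient (spinIsometrySetoid d)

/-- Two matrices are equivalent if they lie in one orbit of the action of `SL(2, ℝ)` by left
multiplication. -/
instance orbitSetoid (d : ℕ) : Setoid (PositiveMatrix d) where
  r M N := ∃ A : SL2R, N.1 = A.1 * M.1
  iseqv :=
    { refl := fun M => ⟨1, by simp⟩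
      symm := by
        rintro M N ⟨A, h⟩
        refine ⟨A⁻¹, ?_⟩
        rw [h, ← Matrix.mul_assoc, ← Matrix.SpecialLinearGroup.coe_mul, inv_mul_cancel,
          Matrix.SpecialLinearGroup.coe_one, Matrix.one_mul]
      trans := by
        rintro M N P ⟨A, h⟩ ⟨B, h'⟩
        exact ⟨B * A, by rw [h', h, Matrix.SpecialLinearGroup.coe_mul, Matrix.mul_assoc]⟩ }

/-- The set of `SL(2, ℝ)`-orbits of real `2 × d` matrices in which all `2 × 2` submatrices have
positive determinant. -/
abbrev MatrixOrbit (d : ℕ) : Type := Quotient (orbitSetoid d)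

end SpinPolygon

end

open scoped ComplexOrder

noncomputable section

namespace SpinPolygon

/-! The theorem reduces to linear algebra on spinors. For a spin frame `W` with first column `κ`,
the basepoint plus the first frame vector is the rank-one matrix `2 κ κ*`. Hence an outward frame on
a horosphere carries a spinor `κ` of its normal, and the frame is determined by `κ` and its
basepoint (`spinFrame_ext`). Parallelism of `V` forces `κ` to be constant up to sign along the
horosphere, and continuity removes the sign. So spin-decorated horospheres are the same as nonzero
spinors (`exists_correspondsTo`, `correspondsTo_ext`, `exists_spinor`). Under this correspondence
spin isometries act by matrix multiplication (`maps_iff`) and the lambda length is the determinant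
of two spinors (`lambdaLength_eq`).

The stabiliser of `eY` in SL(2,ℂ) is SL(2,ℝ), so planar decorations are exactly the real spinors
(`isPlanar_of_realSpinor`, `exists_realSpinor_of_isPlanar`). A spin-coherent polygon is therefore a
list of real vectors with positive 2×2 minors. Its vertices are automatically in cyclic order,
because the orientation of three ideal points is the sign of the product of the three determinants
(`cyclicTriple_idealPoint_iff`).

Forgetting the spin decorations loses only the sign of each vector. Starting from a decorated
polygon, the signs can be chosen relative to the first vertex, and the cyclic order makes the other
minors positive (`exists_gon_eq`). Conversely, an isometry of the plane, of either orientation,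
preserves the squares of the minors: the normal of a horocycle is a fixed linear combination of
three of its points that are characterised by mutual distances (`realDet_sq_eq_of_isometry`).
Positivity then gives equality of the minors, and matrices with equal minors differ by an element of
SL(2,ℝ) (`exists_eq_mul_of_realDet_eq`). -/

/-- The point of the light cone that corresponds to a spinor. -/
def spinorNormal (κ : Fin 2 → ℂ) : Mat2 := (2 : ℂ) • Matrix.vecMulVec κ (star κ)

/-- The determinant of two spinors. -/
def spinorDet (κ μ : Fin 2 → ℂ) : ℂ := κ 0 * μ 1 - κ 1 * μ 0

/-! ### Algebra of the Minkowski form and of the linear action -/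

theorem mulVec_e1 (W : Mat2) : W.mulVec ![1, 0] = fun i => W i 0 := by
  ext i; simp [Matrix.mulVec, dotProduct, Fin.sum_univ_two]

theorem mink_apply (X Y : Mat2) :
    mink X Y = (X 0 0 * Y 1 1 - X 0 1 * Y 1 0 - X 1 0 * Y 0 1 + X 1 1 * Y 0 0).re / 2 := by
  rw [mink_def]
  congr 2
  simp [Matrix.trace_fin_two, Matrix.mul_apply, Fin.sum_univ_two, Matrix.adjugate_fin_two]
  ring

theorem mink_comm (X Y : Mat2) : mink X Y = mink Y X := by
  rw [mink_apply, mink_apply]; congr 2; ring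

theorem mink_add_left (X Y Z : Mat2) : mink (X + Y) Z = mink X Z + mink Y Z := by
  simp only [mink_apply, Matrix.add_apply, Complex.add_re, Complex.sub_re, Complex.mul_re,
    Complex.add_im]
  ring

theorem mink_sub_left (X Y Z : Mat2) : mink (X - Y) Z = mink X Z - mink Y Z := by
  simp only [mink_apply, Matrix.sub_apply, Complex.add_re, Complex.sub_re, Complex.mul_re,
    Complex.sub_im]
  ring

theorem mink_add_right (X Y Z : Mat2) : mink X (Y + Z) = mink X Y + mink X Z := by
  rw [mink_comm, mink_add_left, mink_comm Y, mink_comm Z]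

theorem mink_sub_right (X Y Z : Mat2) : mink X (Y - Z) = mink X Y - mink X Z := by
  rw [mink_comm, mink_sub_left, mink_comm Y, mink_comm Z]

theorem linAct_add (A : SL2C) (X Y : Mat2) : linAct A (X + Y) = linAct A X + linAct A Y := by
  simp [linAct, Matrix.mul_add, Matrix.add_mul]

theorem linAct_inv_linAct (A : SL2C) (X : Mat2) : linAct A⁻¹ (linAct A X) = X := by
  rw [← linAct_mul, inv_mul_cancel, linAct_one]

theorem linAct_linAct_inv (A : SL2C) (X : Mat2) : linAct A (linAct A⁻¹ X) = X := by
  rw [← linAct_mul, mul_inv_cancel, linAct_one]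

theorem linAct_neg_left (A : SL2C) (X : Mat2) : linAct (-A) X = linAct A X := by
  simp [linAct]

theorem linAct_isHermitian (A : SL2C) {X : Mat2} (h : X.IsHermitian) :
    (linAct A X).IsHermitian := by
  have := Matrix.isHermitian_mul_mul_conjTranspose (A : Mat2) h
  exact this

/-! ### Spin frames, their spinors and the standard horosphere -/

theorem coe_basepoint (W : SpinFrame) : (W.basepoint : Mat2) = linAct W 1 := rfl

theorem linAct_spinorNormal (A : SL2C) (κ : Fin 2 → ℂ) :
    linAct A (spinorNormal κ) = spinorNormal ((A : Mat2).mulVec κ) := by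
  simp only [linAct, spinorNormal, Matrix.mul_smul, Matrix.smul_mul, Matrix.mul_vecMulVec,
    Matrix.vecMulVec_mul, Matrix.star_mulVec]

theorem one_add_eZ : 1 + eZ = spinorNormal ![1, 0] := by
  ext i j
  fin_cases i <;> fin_cases j <;>
    norm_num [eZ, spinorNormal, Matrix.vecMulVec_apply, Matrix.smul_apply, Pi.star_apply,
      -Matrix.smul_vecMulVec, -Matrix.vecMulVec_cons, -Matrix.cons_vecMulVec]

/-- The basepoint plus the first frame vector is the image of `1 + eZ`, which is the light cone
point of the spinor `(1, 0)`. So pointing at the centre of a horosphere is a condition on the first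
column alone. -/
theorem frame_zero_eq_iff (W : SpinFrame) (n : Mat2) :
    W.frame 0 = n - W.basepoint ↔ spinorNormal ((W : Mat2).mulVec ![1, 0]) = n := by
  rw [← linAct_spinorNormal, ← one_add_eZ, linAct_add, coe_basepoint, eq_sub_iff_add_eq, add_comm]
  rfl

theorem frame_one (W : SpinFrame) : W.frame 1 = linAct W eY := rfl

theorem basepoint_mul (A : SL2C) (W : SpinFrame) :
    SpinFrame.basepoint (A * W) = A • SpinFrame.basepoint W := mul_smul A W basePoint

/-- The parabolic matrices that fix the spinor `(1, 0)`. -/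
def upper (c : ℂ) : SL2C := ⟨!![1, c; 0, 1], by simp⟩

theorem coe_upper (c : ℂ) : (upper c : Mat2) = !![1, c; 0, 1] := rfl

theorem upper_mulVec (c : ℂ) : (upper c : Mat2).mulVec ![1, 0] = ![1, 0] := by
  rw [mulVec_e1, coe_upper]; ext i; fin_cases i <;> rfl

theorem linAct_upper_one (c : ℂ) : linAct (upper c) 1 = !![1 + c * star c, c; star c, 1] := by
  ext i j
  fin_cases i <;> fin_cases j <;>
    simp [linAct, coe_upper, Matrix.mul_apply, Fin.sum_univ_two]

theorem mink_one_one_add_eZ : mink 1 (1 + eZ) = 1 := by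
  rw [mink_apply]; simp [eZ]

theorem mem_horosphere_of_mulVec {W : SpinFrame} {κ : Fin 2 → ℂ}
    (h : (W : Mat2).mulVec ![1, 0] = κ) : W.basepoint ∈ horosphere (spinorNormal κ) := by
  change mink (linAct W 1) _ = 1
  rw [← h, ← linAct_spinorNormal, mink_linAct, ← one_add_eZ, mink_one_one_add_eZ]

/-- Pairing with `1 + eZ` reads off the lower right entry, so that entry is 1, and the determinant
then fixes the upper left one. The off-diagonal entry remains as a global complex coordinate on the
standard horosphere. -/
theorem eq_upper_smul {S : H3} (h : S ∈ horosphere (spinorNormal ![1, 0])) :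
    S = SpinFrame.basepoint (upper (S.1 0 1)) := by
  apply Subtype.ext
  rw [coe_basepoint, linAct_upper_one]
  have hH := S.2.1.isHermitian
  have hd := S.2.2
  have h00 := hH.apply 0 0
  have h10 := hH.apply 0 1
  have h11 := hH.apply 1 1
  rw [Matrix.det_fin_two] at hd
  have hm : mink S.1 _ = 1 := h
  rw [← one_add_eZ, mink_apply] at hm
  simp [eZ] at hm
  have hS11 : S.1 1 1 = 1 := by
    apply Complex.ext
    · have := hm; norm_num at this; simp; linarith
    · exact Complex.conj_eq_iff_im.mp h11
  rw [hS11, ← h10] at hd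
  ext i j
  fin_cases i <;> fin_cases j
  · simp at hd ⊢
    rw [← h10]
    simp
    linear_combination hd
  · simp
  · simpa using (hH.apply 1 0).symm
  · simpa using hS11

/-- Two frames at one point differ on the right by a unitary matrix. If it also fixes `(1, 0)` and
has determinant 1, it is the identity. -/
theorem spinFrame_ext {W W' : SpinFrame} (hb : W.basepoint = W'.basepoint)
    (hk : (W : Mat2).mulVec ![1, 0] = (W' : Mat2).mulVec ![1, 0]) : W = W' := by
  obtain ⟨U, rfl⟩ : ∃ U, W' = W * U := ⟨W⁻¹ * W', by group⟩
  have h1 : linAct U 1 = 1 := by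
    have := congrArg (fun S : H3 => linAct W⁻¹ S.1) hb
    simp only [coe_basepoint, linAct_mul, linAct_inv_linAct] at this
    exact this.symm
  have h2 : (U : Mat2).mulVec ![1, 0] = ![1, 0] := by
    have := congrArg (fun v => (W⁻¹ : SL2C).1.mulVec v) hk
    simp only [Matrix.mulVec_mulVec, ← Matrix.SpecialLinearGroup.coe_mul,
      inv_mul_cancel_left, inv_mul_cancel] at this
    simpa using this.symm
  rw [mulVec_e1] at h2
  have a := congrFun h2 0
  have c := congrFun h2 1
  have hd := U.2
  rw [Matrix.det_fin_two] at hd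
  simp at a c
  have d : U.1 1 1 = 1 := by simpa [a, c] using hd
  have b : U.1 0 1 = 0 := by
    have := congrFun (congrFun h1 0) 1
    simpa [linAct, Matrix.mul_apply, Fin.sum_univ_two, a, c, d] using this
  have : U = 1 := by
    ext i j
    fin_cases i <;> fin_cases j <;> simp [a, b, c, d]
  simp [this]

/-- The quotient of the two lifts is unitary, so fixing `eZ` and `eY` means commuting with them. The
first makes it diagonal, the second scalar, and determinant 1 leaves only the two sheets of the
double cover. -/
theorem eq_or_eq_neg_of_frame_eq {W W' : SpinFrame} (hb : W.basepoint = W'.basepoint)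
    (h0 : W.frame 0 = W'.frame 0) (h1 : W.frame 1 = W'.frame 1) : W' = W ∨ W' = -W := by
  obtain ⟨U, rfl⟩ : ∃ U, W' = W * U := ⟨W⁻¹ * W', by group⟩
  have key : ∀ X : Mat2, linAct W X = linAct (W * U) X →
      (U : Mat2) * X * U.1.conjTranspose = X := by
    intro X h
    rw [linAct_mul] at h
    have := congrArg (linAct W⁻¹) h
    simp only [linAct_inv_linAct] at this
    exact this.symm
  have k1 := key 1 (congrArg Subtype.val hb)
  have kZ := key eZ h0
  have kY := key eY h1
  have hU : U.1.conjTranspose * U.1 = 1 := by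
    rw [Matrix.mul_one] at k1
    exact mul_eq_one_comm.mp k1
  have comm : ∀ X : Mat2, (U : Mat2) * X * U.1.conjTranspose = X → U.1 * X = X * U.1 := by
    intro X h
    rw [← h, Matrix.mul_assoc _ _ U.1, hU, Matrix.mul_one, h]
  have cZ := comm _ kZ
  have cY := comm _ kY
  have b := congrFun (congrFun cZ 0) 1
  have c := congrFun (congrFun cZ 1) 0
  have ad := congrFun (congrFun cY 0) 1
  simp [Matrix.mul_apply, Fin.sum_univ_two, eZ, eY] at b c ad
  have b0 : U.1 0 1 = 0 := by linear_combination (-1/2 : ℂ) * b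
  have c0 : U.1 1 0 = 0 := by linear_combination (1/2 : ℂ) * c
  have ad' : U.1 0 0 = U.1 1 1 := by
    have := Complex.I_ne_zero
    apply mul_right_cancel₀ this
    linear_combination ad
  have hd := U.2
  rw [Matrix.det_fin_two, b0, ad'] at hd
  have hs : (U.1 1 1 - 1) * (U.1 1 1 + 1) = 0 := by linear_combination hd
  rcases mul_eq_zero.mp hs with h | h
  · left
    have h := sub_eq_zero.mp h
    have : U = 1 := by
      ext i j
      fin_cases i <;> fin_cases j <;> simp [ad', b0, c0, h]
    simp [this]
  · right
    have h := eq_neg_of_add_eq_zero_left h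
    have : U = -1 := by
      ext i j
      fin_cases i <;> fin_cases j <;> simp [ad', b0, c0, h]
    simp [this]

/-! ### Nonzero spinors and the light cone -/

theorem isCoprime_of_ne_zero {F : Type*} [Field F] {v : Fin 2 → F} (h : v ≠ 0) :
    IsCoprime (v 0) (v 1) := by
  by_cases h0 : v 0 = 0
  · have h1 : v 1 ≠ 0 := fun h1 => h (by ext i; fin_cases i <;> assumption)
    exact ⟨0, (v 1)⁻¹, by simp [h1]⟩
  · exact ⟨(v 0)⁻¹, 0, by simp [h0]⟩

theorem exists_mulVec_eq {κ : Fin 2 → ℂ} (h : κ ≠ 0) :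
    ∃ A : SL2C, (A : Mat2).mulVec ![1, 0] = κ := by
  obtain ⟨A, h0, h1⟩ := (isCoprime_of_ne_zero h).exists_SL2_col 0
  refine ⟨A, ?_⟩
  rw [mulVec_e1]; ext i; fin_cases i <;> assumption

theorem mulVec_ne_zero (W : SL2C) : (W : Mat2).mulVec ![1, 0] ≠ 0 := by
  intro h
  have := congrArg (fun v => (W⁻¹ : SL2C).1.mulVec v) h
  simp only [Matrix.mulVec_mulVec, ← Matrix.SpecialLinearGroup.coe_mul, inv_mul_cancel,
    Matrix.mulVec_zero, Matrix.SpecialLinearGroup.coe_one, Matrix.one_mulVec] at this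
  simpa using congrFun this 0

theorem inv_smul_mem_horosphere {A : SL2C} {κ : Fin 2 → ℂ} (hA : (A : Mat2).mulVec ![1, 0] = κ)
    {S : H3} (hS : S ∈ horosphere (spinorNormal κ)) :
    A⁻¹ • S ∈ horosphere (spinorNormal ![1, 0]) := by
  change mink (linAct A⁻¹ S.1) _ = 1
  rw [← mink_linAct A, linAct_linAct_inv, linAct_spinorNormal, hA]
  exact hS

/-- A positive semidefinite Hermitian matrix of rank one is `2 κ κ*`, with `κ` unique up to phase.
The phase is normalised by making the second coordinate positive, or the first if the second
vanishes. -/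
theorem exists_spinorNormal_eq {n : Mat2} (hn : n ∈ lightCone) :
    ∃ κ : Fin 2 → ℂ, κ ≠ 0 ∧ n = spinorNormal κ := by
  obtain ⟨hH, hd, ht⟩ := hn
  have h00 : ((n 0 0).re : ℂ) = n 0 0 := Complex.conj_eq_iff_re.mp (hH.apply 0 0)
  have h11 : ((n 1 1).re : ℂ) = n 1 1 := Complex.conj_eq_iff_re.mp (hH.apply 1 1)
  have h10 : star (n 0 1) = n 1 0 := hH.apply 1 0
  rw [Matrix.det_fin_two, ← h10] at hd
  rw [Matrix.trace_fin_two, Complex.add_re] at ht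
  generalize (n 0 0).re = a at *
  generalize (n 1 1).re = e at *
  have hd' : a * e = Complex.normSq (n 0 1) := by
    have : n 0 1 * star (n 0 1) = Complex.normSq (n 0 1) := Complex.mul_conj _
    rw [this, ← h00, ← h11] at hd
    exact_mod_cast sub_eq_zero.mp hd
  have hns := Complex.normSq_nonneg (n 0 1)
  rcases lt_trichotomy e 0 with he | he | he
  · nlinarith
  · subst he
    have hb : n 0 1 = 0 := by
      rw [mul_zero] at hd'
      exact Complex.normSq_eq_zero.mp hd'.symm
    have ha : 0 < a := by linarith
    have hs : ((Real.sqrt (a / 2) : ℝ) : ℂ) * (Real.sqrt (a / 2) : ℝ) = a / 2 := by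
      have := Real.mul_self_sqrt (show 0 ≤ a / 2 by positivity)
      exact_mod_cast this
    have hs0 : ((Real.sqrt (a / 2) : ℝ) : ℂ) ≠ 0 := by
      rw [Complex.ofReal_ne_zero]
      positivity
    generalize hsg : ((Real.sqrt (a / 2) : ℝ) : ℂ) = s at *
    have hstar : (starRingEnd ℂ) s = s := by rw [← hsg]; exact Complex.conj_ofReal _
    refine ⟨![s, 0], ?_, ?_⟩
    · intro h
      exact hs0 (by simpa using congrFun h 0)
    · ext i j
      fin_cases i <;> fin_cases j <;> simp [spinorNormal, Matrix.smul_apply, -Matrix.smul_vecMulVec,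
        Matrix.vecMulVec_apply, -Matrix.vecMulVec_cons, -Matrix.cons_vecMulVec, hb, ← h10, ← h11,
        hstar]
      rw [hs, ← h00]
      ring
  · have hs : ((Real.sqrt (e / 2) : ℝ) : ℂ) * (Real.sqrt (e / 2) : ℝ) = e / 2 := by
      have := Real.mul_self_sqrt (show 0 ≤ e / 2 by positivity)
      exact_mod_cast this
    have hs0 : ((Real.sqrt (e / 2) : ℝ) : ℂ) ≠ 0 := by
      rw [Complex.ofReal_ne_zero]
      positivity
    have he0 : (e : ℂ) ≠ 0 := by exact_mod_cast he.ne'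
    generalize hsg : ((Real.sqrt (e / 2) : ℝ) : ℂ) = s at *
    have hstar : (starRingEnd ℂ) s = s := by rw [← hsg]; exact Complex.conj_ofReal _
    refine ⟨![n 0 1 / (2 * s), s], ?_, ?_⟩
    · intro h
      exact hs0 (by simpa using congrFun h 1)
    · ext i j
      fin_cases i <;> fin_cases j <;> simp [spinorNormal, Matrix.smul_apply, -Matrix.smul_vecMulVec,
        Matrix.vecMulVec_apply, -Matrix.vecMulVec_cons, -Matrix.cons_vecMulVec, hstar, ← h10]
      · have h2 : n 0 1 * (starRingEnd ℂ) (n 0 1) = a * e := by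
          rw [Complex.mul_conj, ← hd']; push_cast; rfl
        rw [← h00]
        field_simp
        rw [h2]
        linear_combination (2 : ℂ) * a * hs
      · field_simp
      · field_simp
      · rw [hs, ← h11]; ring

theorem spinorNormal_mem_lightCone {κ : Fin 2 → ℂ} (hκ : κ ≠ 0) :
    spinorNormal κ ∈ lightCone := by
  refine ⟨?_, ?_, ?_⟩
  · ext i j
    simp [spinorNormal, Matrix.vecMulVec_apply, mul_comm]
  · rw [Matrix.det_fin_two]
    simp [spinorNormal, Matrix.vecMulVec_apply]
    ring
  · rw [Matrix.trace_fin_two]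
    have h : ∀ i, (spinorNormal κ i i).re = 2 * Complex.normSq (κ i) := by
      intro i
      have : spinorNormal κ i i = (2 * Complex.normSq (κ i) : ℝ) := by
        push_cast
        rw [← Complex.mul_conj]
        simp [spinorNormal, Matrix.vecMulVec_apply]
      rw [this, Complex.ofReal_re]
    rw [Complex.add_re, h, h]
    obtain ⟨i, hi⟩ := Function.ne_iff.mp hκ
    have hp := Complex.normSq_pos.mpr hi
    have h0 := Complex.normSq_nonneg (κ 0)
    have h1 := Complex.normSq_nonneg (κ 1)
    fin_cases i <;> simp at hp <;> linarith [Complex.normSq_pos.mpr hp]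

/-! ### Parabolic isometries that preserve a horosphere -/

theorem mink_eY_one : mink eY 1 = 0 := by
  rw [mink_apply]; simp [eY]

theorem mink_eY_one_add_eZ : mink eY (1 + eZ) = 0 := by
  rw [mink_apply]; simp [eY, eZ]

theorem mink_eY_eY : mink eY eY = -1 := by
  rw [mink_apply]; simp [eY]; norm_num

theorem eY_isHermitian : eY.IsHermitian := by
  ext i j
  fin_cases i <;> fin_cases j <;> simp [eY]

/-- If the lower row of `Q` is `(g, h)`, the point with coordinate `c` stays on the horosphere only
if `|g|² + |g c + h|² = 1`. Holding for all `c`, this forces `g = 0`, and the trace condition then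
makes both diagonal entries 1 or both -1. -/
theorem mulVec_eq_or_eq_neg_of_fixes_standard {Q : SL2C}
    (ht : (Q : Mat2).trace = 2 ∨ (Q : Mat2).trace = -2)
    (hQ : ∀ S : H3, S ∈ horosphere (spinorNormal ![1, 0]) →
      Q • S ∈ horosphere (spinorNormal ![1, 0])) :
    (Q : Mat2).mulVec ![1, 0] = ![1, 0] ∨ (Q : Mat2).mulVec ![1, 0] = -![1, 0] := by
  have h : ∀ c : ℂ, Complex.normSq (Q.1 1 0) + Complex.normSq (Q.1 1 0 * c + Q.1 1 1) = 1 := by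
    intro c
    have h := hQ _ (mem_horosphere_of_mulVec (upper_mulVec c))
    rw [← basepoint_mul] at h
    have h : mink (linAct (Q * upper c) 1) _ = 1 := h
    rw [← one_add_eZ, mink_apply] at h
    simp [eZ, linAct, coe_upper, Matrix.mul_apply, Fin.sum_univ_two] at h
    simp only [Complex.normSq_apply, Complex.mul_re, Complex.mul_im, Complex.add_re,
      Complex.add_im]
    linarith
  have hg : Q.1 1 0 = 0 := by
    by_contra hg
    -- This `c` makes `g c + h = 2`, whose squared norm 4 already exceeds 1.
    have h1 := h ((2 - Q.1 1 1) / Q.1 1 0)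
    rw [mul_div_cancel₀ _ hg, sub_add_cancel] at h1
    have := Complex.normSq_nonneg (Q.1 1 0)
    have h4 : Complex.normSq 2 = 4 := by norm_num [Complex.normSq_apply]
    linarith
  have hd := Q.2
  rw [Matrix.det_fin_two, hg] at hd
  rw [mulVec_e1]
  rw [Matrix.trace_fin_two] at ht
  rcases ht with ht | ht
  · left
    have h1 : (Q.1 0 0 - 1) ^ 2 = 0 := by linear_combination Q.1 0 0 * ht - hd
    have := sub_eq_zero.mp (pow_eq_zero_iff two_ne_zero |>.mp h1)
    ext i; fin_cases i <;> simp [this, hg]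
  · right
    have h1 : (Q.1 0 0 + 1) ^ 2 = 0 := by linear_combination Q.1 0 0 * ht - hd
    have := eq_neg_of_add_eq_zero_left (pow_eq_zero_iff two_ne_zero |>.mp h1)
    ext i; fin_cases i <;> simp [this, hg]

theorem smul_mem_horosphere {A : SL2C} {n : Mat2} {S : H3} (h : S ∈ horosphere n) :
    A • S ∈ horosphere (linAct A n) := by
  change mink (linAct A S.1) _ = 1
  rw [mink_linAct]; exact h

/-- A parabolic isometry that preserves the horosphere of a spinor fixes the spinor up to sign. -/
theorem mulVec_eq_or_eq_neg_of_fixes {P : SL2C} {κ : Fin 2 → ℂ} (hκ : κ ≠ 0)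
    (ht : (P : Mat2).trace = 2 ∨ (P : Mat2).trace = -2)
    (hP : ∀ S : H3, P • S ∈ horosphere (spinorNormal κ) ↔ S ∈ horosphere (spinorNormal κ)) :
    (P : Mat2).mulVec κ = κ ∨ (P : Mat2).mulVec κ = -κ := by
  obtain ⟨A, rfl⟩ := exists_mulVec_eq hκ
  -- Conjugation by `A` keeps the trace and moves the horosphere to the standard one.
  have hQ := mulVec_eq_or_eq_neg_of_fixes_standard (Q := A⁻¹ * P * A)
    (by
      have : ((A⁻¹ * P * A : SL2C) : Mat2).trace = (P : Mat2).trace := by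
        rw [Matrix.SpecialLinearGroup.coe_mul, Matrix.trace_mul_comm,
          ← Matrix.SpecialLinearGroup.coe_mul, mul_inv_cancel_left]
      rwa [this])
    (fun S hS => by
      rw [mul_assoc, mul_smul, mul_smul]
      apply inv_smul_mem_horosphere rfl
      rw [hP, ← linAct_spinorNormal]
      exact smul_mem_horosphere hS)
  have key : (P : Mat2).mulVec ((A : Mat2).mulVec ![1, 0])
      = (A : Mat2).mulVec (((A⁻¹ * P * A : SL2C) : Mat2).mulVec ![1, 0]) := by
    simp only [Matrix.mulVec_mulVec, ← Matrix.SpecialLinearGroup.coe_mul]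
    rw [mul_assoc, mul_inv_cancel_left]
  rw [key]
  rcases hQ with h | h
  · left; rw [h]
  · right; rw [h, Matrix.mulVec_neg]

/-! ### The spin decoration of a spinor -/

theorem continuous_upper : Continuous upper :=
  Continuous.subtype_mk (by
    refine continuous_matrix fun i j => ?_
    fin_cases i <;> fin_cases j <;> simp <;> fun_prop) _

/-- The outward spin frames on a horosphere, in terms of one of their elements. -/
def outwardFrame (A : SL2C) (S : H3) : SpinFrame := A * upper ((A⁻¹ • S : H3).1 0 1)

theorem outwardFrame_mulVec (A : SL2C) (S : H3) :
    (outwardFrame A S : Mat2).mulVec ![1, 0] = (A : Mat2).mulVec ![1, 0] := by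
  rw [outwardFrame, Matrix.SpecialLinearGroup.coe_mul, ← Matrix.mulVec_mulVec, upper_mulVec]

theorem outwardFrame_basepoint {A : SL2C} {κ : Fin 2 → ℂ} (hA : (A : Mat2).mulVec ![1, 0] = κ)
    {S : H3} (hS : S ∈ horosphere (spinorNormal κ)) :
    SpinFrame.basepoint (outwardFrame A S) = S := by
  rw [outwardFrame, basepoint_mul, ← eq_upper_smul (inv_smul_mem_horosphere hA hS),
    smul_inv_smul]

theorem continuous_outwardFrame (A : SL2C) : Continuous (outwardFrame A) := by
  refine continuous_const.mul (continuous_upper.comp ?_)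
  have : Continuous fun S : H3 => linAct A⁻¹ S.1 := by
    unfold linAct; fun_prop
  exact this.matrix_elem 0 1

theorem linAct_rot_eY (θ : ℝ) : linAct (rotSecond θ) eY = eY := by
  have h : (Real.cos (θ / 2) : ℂ) ^ 2 + (Real.sin (θ / 2) : ℂ) ^ 2 = 1 := by
    exact_mod_cast Real.cos_sq_add_sin_sq (θ / 2)
  have hc := Complex.conj_ofReal (Real.cos (θ / 2))
  have hs := Complex.conj_ofReal (Real.sin (θ / 2))
  generalize hc' : (Real.cos (θ / 2) : ℂ) = c at h hc
  generalize hs' : (Real.sin (θ / 2) : ℂ) = s at h hs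
  ext i j
  fin_cases i <;> fin_cases j <;>
    simp [linAct, rotSecond, eY, Matrix.mul_apply, Fin.sum_univ_two, hc', hs', hc, hs,
      -Complex.ofReal_cos, -Complex.ofReal_sin]
  · ring
  · linear_combination Complex.I * h
  · linear_combination -Complex.I * h
  · ring

theorem coe_rotSecond_pi : (rotSecond Real.pi : Mat2) = !![0, -1; 1, 0] := by
  simp [rotSecond]

theorem linAct_rot_one : linAct (rotSecond Real.pi) 1 = 1 := by
  rw [linAct, coe_rotSecond_pi]
  ext i j
  fin_cases i <;> fin_cases j <;> simp [Matrix.mul_apply, Fin.sum_univ_two]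

theorem linAct_rot_eZ : linAct (rotSecond Real.pi) eZ = -eZ := by
  rw [linAct, coe_rotSecond_pi]
  ext i j
  fin_cases i <;> fin_cases j <;> simp [eZ, Matrix.mul_apply, Fin.sum_univ_two]

theorem linAct_neg (A : SL2C) (X : Mat2) : linAct A (-X) = -linAct A X := by
  simp [linAct]

theorem basepoint_mul_rot (W : SpinFrame) :
    SpinFrame.basepoint (W * rotSecond Real.pi) = W.basepoint := by
  apply Subtype.ext
  rw [coe_basepoint, coe_basepoint, linAct_mul, linAct_rot_one]

theorem frame_zero_mul_rot (W : SpinFrame) :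
    SpinFrame.frame (W * rotSecond Real.pi) 0 = -W.frame 0 := by
  change linAct _ _ = -linAct _ _
  rw [linAct_mul, linAct_rot_eZ, linAct_neg]

theorem frame_one_mul_rot (W : SpinFrame) :
    SpinFrame.frame (W * rotSecond Real.pi) 1 = W.frame 1 := by
  rw [frame_one, frame_one, linAct_mul, linAct_rot_eY]

/-- A parabolic isometry `P` preserving the horosphere sends the spinor to plus or minus itself.
Hence it sends the outward frame at `S` to plus or minus the one at `P • S`, and the sign does not
affect the underlying frame vectors. -/
theorem isParallelUnitField_outwardFrame (A : SL2C) :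
    IsParallelUnitField (spinorNormal ((A : Mat2).mulVec ![1, 0]))
      (fun S => SpinFrame.frame (outwardFrame A S) 1) := by
  set κ := (A : Mat2).mulVec ![1, 0] with hκ
  refine ⟨fun S => ?_, fun P ht hP S S' hS => ?_⟩
  · have hb : S.1.1 = linAct (outwardFrame A S) 1 := by
      rw [← coe_basepoint, outwardFrame_basepoint rfl S.2]
    have hn : spinorNormal κ = linAct (outwardFrame A S) (1 + eZ) := by
      rw [one_add_eZ, linAct_spinorNormal, outwardFrame_mulVec]
    simp only [frame_one]
    refine ⟨linAct_isHermitian _ eY_isHermitian, ?_, ?_, ?_⟩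
    · rw [hb, mink_linAct, mink_eY_one]
    · exact (congrArg (mink _) hn).trans (by rw [mink_linAct, mink_eY_one_add_eZ])
    · rw [mink_linAct, mink_eY_eY]
  · simp only [frame_one, ← linAct_mul]
    have hb : SpinFrame.basepoint (P * outwardFrame A S) =
        SpinFrame.basepoint (outwardFrame A S') := by
      rw [basepoint_mul, outwardFrame_basepoint rfl S.2, outwardFrame_basepoint rfl S'.2, hS]
    rcases mulVec_eq_or_eq_neg_of_fixes (mulVec_ne_zero A) ht hP with h | h
    · rw [spinFrame_ext hb (by
        rw [Matrix.SpecialLinearGroup.coe_mul, ← Matrix.mulVec_mulVec, outwardFrame_mulVec,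
          outwardFrame_mulVec, h])]
    · rw [← linAct_neg_left (P * _), spinFrame_ext (W := -(P * outwardFrame A S))
        (W' := outwardFrame A S') (by
          rw [← hb]; apply Subtype.ext; exact linAct_neg_left _ _) (by
          rw [Matrix.SpecialLinearGroup.coe_neg, Matrix.neg_mulVec,
            Matrix.SpecialLinearGroup.coe_mul, ← Matrix.mulVec_mulVec, outwardFrame_mulVec,
          outwardFrame_mulVec, h, neg_neg])]

/-- The spin-decorated horosphere of the spinor `A (1, 0)`. -/
def decorationOf (A : SL2C) : SpinDecoratedHorosphere where
  normal := spinorNormal ((A : Mat2).mulVec ![1, 0])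
  normal_mem := spinorNormal_mem_lightCone (mulVec_ne_zero A)
  inward S := outwardFrame A S * rotSecond Real.pi
  outward S := outwardFrame A S
  isSpinDecoration := by
    have h0 : ∀ S : horosphere (spinorNormal ((A : Mat2).mulVec ![1, 0])),
        SpinFrame.frame (outwardFrame A S) 0
          = spinorNormal ((A : Mat2).mulVec ![1, 0]) - S.1.1 := by
      intro S
      have := (frame_zero_eq_iff (outwardFrame A S) _).mpr
        (congrArg spinorNormal (outwardFrame_mulVec A S))
      rwa [outwardFrame_basepoint rfl S.2] at this
    refine ⟨⟨_, isParallelUnitField_outwardFrame A, ⟨?_, fun S => ⟨?_, ?_, ?_⟩⟩, ?_, fun S =>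
      ⟨?_, ?_, rfl⟩⟩, fun S => rfl⟩
    · exact ((continuous_outwardFrame A).comp continuous_subtype_val).mul continuous_const
    · rw [basepoint_mul_rot, outwardFrame_basepoint rfl S.2]
    · rw [frame_zero_mul_rot, h0, neg_sub]
    · rw [frame_one_mul_rot]
    · exact (continuous_outwardFrame A).comp continuous_subtype_val
    · rw [outwardFrame_basepoint rfl S.2]
    · exact h0 S

theorem exists_correspondsTo {κ : Fin 2 → ℂ} (hκ : κ ≠ 0) : ∃ D, CorrespondsTo D κ := by
  obtain ⟨A, rfl⟩ := exists_mulVec_eq hκ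
  exact ⟨decorationOf A, rfl, fun S => outwardFrame_mulVec A S⟩

/-! ### Every spin decoration comes from a unique spinor -/

namespace SpinDecoratedHorosphere
variable (D : SpinDecoratedHorosphere)

theorem inward_eq (S : horosphere D.normal) : D.inward S = D.outward S * rotSecond Real.pi :=
  D.isSpinDecoration.2 S

theorem basepoint_outward (S : horosphere D.normal) : SpinFrame.basepoint (D.outward S) = S.1 := by
  obtain ⟨V, -, -, h⟩ := D.isSpinDecoration.1
  exact (h.2 S).1

theorem spinorNormal_outward (S : horosphere D.normal) :
    spinorNormal ((D.outward S : Mat2).mulVec ![1, 0]) = D.normal := by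
  obtain ⟨V, -, -, h⟩ := D.isSpinDecoration.1
  rw [← frame_zero_eq_iff, (h.2 S).2.1, basepoint_outward]

theorem horosphere_nonempty : ∃ S, S ∈ horosphere D.normal := by
  obtain ⟨κ, hκ, h⟩ := exists_spinorNormal_eq D.normal_mem
  obtain ⟨A, rfl⟩ := exists_mulVec_eq hκ
  exact ⟨_, by rw [h]; exact mem_horosphere_of_mulVec (W := A) rfl⟩

end SpinDecoratedHorosphere

/-- Spinor and basepoint determine each outward frame, and inward frames are rotated outward ones.
-/
theorem correspondsTo_ext {D D' : SpinDecoratedHorosphere} {κ : Fin 2 → ℂ}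
    (h : CorrespondsTo D κ) (h' : CorrespondsTo D' κ) : D = D' := by
  have ho : ∀ S S', S.1 = S'.1 → D.outward S = D'.outward S' := fun S S' hS =>
    spinFrame_ext (by rw [D.basepoint_outward, D'.basepoint_outward, hS])
      ((h.2 S).trans (h'.2 S').symm)
  have hi : ∀ S S', S.1 = S'.1 → D.inward S = D'.inward S' := fun S S' hS => by
    rw [D.inward_eq, D'.inward_eq, ho S S' hS]
  have hn : D.normal = D'.normal := h.1.trans h'.1.symm
  clear h h'
  obtain ⟨n, _, Win, Wout, _⟩ := D
  obtain ⟨n', _, Win', Wout', _⟩ := D'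
  obtain rfl : n = n' := hn
  obtain rfl : Win = Win' := funext fun S => hi S S rfl
  obtain rfl : Wout = Wout' := funext fun S => ho S S rfl
  rfl

theorem CorrespondsTo.unique {D : SpinDecoratedHorosphere} {κ μ : Fin 2 → ℂ}
    (h : CorrespondsTo D κ) (h' : CorrespondsTo D μ) : κ = μ := by
  obtain ⟨S, hS⟩ := D.horosphere_nonempty
  exact (h.2 ⟨S, hS⟩).symm.trans (h'.2 ⟨S, hS⟩)

theorem trace_conj (A P : SL2C) : ((A * P * A⁻¹ : SL2C) : Mat2).trace = (P : Mat2).trace := by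
  rw [Matrix.SpecialLinearGroup.coe_mul, Matrix.trace_mul_comm,
    ← Matrix.SpecialLinearGroup.coe_mul, inv_mul_cancel_left]

/-- Each spin-decorated horosphere corresponds to a spinor: its parallel field and its normal
determine the spinor up to sign, and the sign is constant by continuity. -/
theorem exists_spinor (D : SpinDecoratedHorosphere) : ∃ κ, κ ≠ 0 ∧ CorrespondsTo D κ := by
  obtain ⟨S₀, hS₀⟩ := D.horosphere_nonempty
  set A := D.outward ⟨S₀, hS₀⟩ with hA
  have hA₀ : A.basepoint = S₀ := D.basepoint_outward _
  set κ := (A : Mat2).mulVec ![1, 0] with hκ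
  have hn : D.normal = spinorNormal κ := (D.spinorNormal_outward ⟨S₀, hS₀⟩).symm
  have hmem : ∀ c, SpinFrame.basepoint (A * upper c) ∈ horosphere D.normal := by
    intro c
    rw [hn]
    apply mem_horosphere_of_mulVec
    rw [Matrix.SpecialLinearGroup.coe_mul, ← Matrix.mulVec_mulVec, upper_mulVec]
  -- These conjugates of `upper c` are parabolic and preserve the horosphere. Invariance of `V`
  -- under them carries the frame at `S₀` to every other point, up to the choice of lift.
  have hfix : ∀ c, linAct (A * upper c * A⁻¹) D.normal = D.normal := by
    intro c
    rw [hn, hκ, linAct_spinorNormal, Matrix.mulVec_mulVec, ← Matrix.SpecialLinearGroup.coe_mul,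
      inv_mul_cancel_right, Matrix.SpecialLinearGroup.coe_mul, ← Matrix.mulVec_mulVec,
      upper_mulVec]
  obtain ⟨V, hV, -, hW⟩ := D.isSpinDecoration.1
  have hsign : ∀ c, D.outward ⟨_, hmem c⟩ = A * upper c ∨
      D.outward ⟨_, hmem c⟩ = -(A * upper c) := by
    intro c
    have hbase : SpinFrame.basepoint (A * upper c) = (A * upper c * A⁻¹) • S₀ := by
      rw [← hA₀, ← basepoint_mul, inv_mul_cancel_right]
    apply eq_or_eq_neg_of_frame_eq
    · rw [D.basepoint_outward]
    · rw [(hW.2 _).2.1, frame_zero_eq_iff .. |>.mpr]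
      rw [Matrix.SpecialLinearGroup.coe_mul, ← Matrix.mulVec_mulVec, upper_mulVec, hn]
    · rw [(hW.2 _).2.2, hV.2 (A * upper c * A⁻¹) (Or.inl (by
        rw [trace_conj, Matrix.trace_fin_two, coe_upper]; simp; norm_num)) (fun S => by
          change mink (linAct _ S.1) _ = 1 ↔ mink S.1 _ = 1
          nth_rw 1 [← hfix c]
          rw [mink_linAct]) ⟨S₀, hS₀⟩ _ hbase, ← (hW.2 _).2.2, ← hA, frame_one, frame_one,
          ← linAct_mul, inv_mul_cancel_right]
  let f : ℂ → Fin 2 → ℂ := fun c => (D.outward ⟨_, hmem c⟩ : Mat2).mulVec ![1, 0]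
  have hf : ∀ c, f c = κ ∨ f c = -κ := by
    intro c
    rcases hsign c with h | h
    · left
      simp only [f, h, Matrix.SpecialLinearGroup.coe_mul, ← Matrix.mulVec_mulVec, upper_mulVec, hκ]
    · right
      simp only [f, h, Matrix.SpecialLinearGroup.coe_neg, Matrix.neg_mulVec,
        Matrix.SpecialLinearGroup.coe_mul, ← Matrix.mulVec_mulVec, upper_mulVec, hκ]
  have hcont : Continuous f := by
    have h1 : Continuous fun c => (⟨_, hmem c⟩ : horosphere D.normal) := by
      refine Continuous.subtype_mk (Continuous.subtype_mk ?_ _) _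
      have : Continuous fun c => ((A * upper c : SL2C) : Mat2) :=
        continuous_subtype_val.comp (continuous_const.mul continuous_upper)
      unfold linAct
      fun_prop
    have h2 : Continuous fun c => (D.outward ⟨_, hmem c⟩ : Mat2) :=
      continuous_subtype_val.comp (hW.1.comp h1)
    exact h2.matrix_mulVec continuous_const
  -- The map `f` is continuous on the connected plane and takes values in the discrete set `{κ,
  -- -κ}`.
  have hconst : ∀ c, f c = f 0 := fun c =>
    isPreconnected_univ.constant_of_mapsTo (T := {κ, -κ}) (Set.toFinite _).isDiscrete
      hcont.continuousOn (fun c _ => hf c) trivial trivial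
  have hf0 : f 0 = κ := by
    have h : (⟨_, hmem 0⟩ : horosphere D.normal) = ⟨S₀, hS₀⟩ := by
      apply Subtype.ext
      have h0 : upper 0 = 1 := by
        ext i j; fin_cases i <;> fin_cases j <;> rfl
      change SpinFrame.basepoint (A * upper 0) = S₀
      rw [h0, mul_one, hA₀]
    exact congrArg (fun S => (D.outward S : Mat2).mulVec ![1, 0]) h
  refine ⟨κ, mulVec_ne_zero A, hn, fun S => ?_⟩
  have hS : S.1 ∈ horosphere (spinorNormal κ) := by rw [← hn]; exact S.2
  have := outwardFrame_basepoint (A := A) rfl hS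
  have hS' : S = ⟨_, hmem ((A⁻¹ • S.1 : H3).1 0 1)⟩ := Subtype.ext this.symm
  rw [hS']
  exact (hconst _).trans hf0

/-! ### Lambda lengths -/

/-- Let `W` be the outward frame with first column `κ₁`. Rotation through `π` brings its second
column to the front and the screw motion scales that by `exp (d / 2)`, giving `κ₂`; then use `det W
= 1`. In particular the value does not depend on which `d` is chosen. -/
theorem IsHorosphereDistance.exp_eq {D₁ D₂ : SpinDecoratedHorosphere} {κ₁ κ₂ : Fin 2 → ℂ}
    (h₁ : CorrespondsTo D₁ κ₁) (h₂ : CorrespondsTo D₂ κ₂) {d : ℂ}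
    (h : IsHorosphereDistance D₁ D₂ d) : Complex.exp (d / 2) = spinorDet κ₁ κ₂ := by
  obtain ⟨q₁, q₂, -, -, h⟩ := h
  have e₁ := h₁.2 q₁
  have e₂ := h₂.2 q₂
  rw [IsComplexDistance, D₁.inward_eq] at h
  generalize D₁.outward q₁ = W at *
  rw [h] at e₂
  rw [mulVec_e1] at e₁ e₂
  have hd := W.2
  rw [Matrix.det_fin_two] at hd
  subst e₁ e₂
  rw [Matrix.SpecialLinearGroup.coe_mul, Matrix.SpecialLinearGroup.coe_mul, coe_rotSecond_pi]
  simp [spinorDet, screwFirst, Matrix.mul_apply, Fin.sum_univ_two]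
  linear_combination -Complex.exp (d / 2) * hd

/-- The matrix with columns `κ` and `μ`. -/
def ofCols (κ μ : Fin 2 → ℂ) (h : spinorDet κ μ = 1) : SL2C :=
  ⟨!![κ 0, μ 0; κ 1, μ 1], by rw [Matrix.det_fin_two_of, ← h, spinorDet]; ring⟩

theorem ofCols_mulVec (κ μ : Fin 2 → ℂ) (h : spinorDet κ μ = 1) :
    (ofCols κ μ h : Mat2).mulVec ![1, 0] = κ := by
  rw [mulVec_e1]; ext i; fin_cases i <;> rfl

theorem onGeodesic_of_coe_eq {κ₁ κ₂ : Fin 2 → ℂ} {n₁ n₂ : Mat2}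
    (h₁ : n₁ = spinorNormal κ₁) (h₂ : n₂ = spinorNormal κ₂)
    {a b : ℝ} (ha : 0 < a) (hb : 0 < b) {S : H3}
    (h : ∀ i j, S.1 i j = a * (κ₁ i * star (κ₁ j)) + b * (κ₂ i * star (κ₂ j))) :
    OnGeodesic n₁ n₂ S := by
  subst h₁ h₂
  -- The halves cancel the factor 2 in `spinorNormal`.
  refine ⟨a / 2, b / 2, by positivity, by positivity, ?_⟩
  ext i j
  simp only [h, spinorNormal, Matrix.add_apply, Matrix.smul_apply, Matrix.vecMulVec_apply,
    Pi.star_apply, Complex.real_smul, smul_eq_mul]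
  push_cast
  ring

/-- With `l` the determinant of the spinors, the frames with columns `κ₁, l⁻¹ κ₂` and `κ₂, -l⁻¹ κ₁`
are outward frames of the two horospheres. Their basepoints are positive combinations of `κ₁ κ₁*`
and `κ₂ κ₂*`, hence lie on the geodesic between the centres. -/
theorem exists_isHorosphereDistance {D₁ D₂ : SpinDecoratedHorosphere} {κ₁ κ₂ : Fin 2 → ℂ}
    (h₁ : CorrespondsTo D₁ κ₁) (h₂ : CorrespondsTo D₂ κ₂) (h : spinorDet κ₁ κ₂ ≠ 0) :
    ∃ d, IsHorosphereDistance D₁ D₂ d := by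
  set l := spinorDet κ₁ κ₂ with hl
  have hl' : κ₁ 0 * κ₂ 1 - κ₁ 1 * κ₂ 0 = l := rfl
  have d₁ : spinorDet κ₁ (l⁻¹ • κ₂) = 1 := by
    simp [spinorDet]; field_simp; linear_combination hl'
  have d₂ : spinorDet κ₂ (-l⁻¹ • κ₁) = 1 := by
    simp [spinorDet]; field_simp; linear_combination hl'
  have c₁ := ofCols_mulVec _ _ d₁
  have c₂ := ofCols_mulVec _ _ d₂
  have m₁ := mem_horosphere_of_mulVec c₁
  have m₂ := mem_horosphere_of_mulVec c₂
  rw [show spinorNormal κ₁ = D₁.normal from h₁.1.symm] at m₁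
  rw [show spinorNormal κ₂ = D₂.normal from h₂.1.symm] at m₂
  have o₁ : D₁.outward ⟨_, m₁⟩ = ofCols _ _ d₁ :=
    spinFrame_ext (D₁.basepoint_outward _) ((h₁.2 _).trans c₁.symm)
  have o₂ : D₂.outward ⟨_, m₂⟩ = ofCols _ _ d₂ :=
    spinFrame_ext (D₂.basepoint_outward _) ((h₂.2 _).trans c₂.symm)
  have hp : 0 < Complex.normSq l⁻¹ := Complex.normSq_pos.mpr (inv_ne_zero h)
  have hn : (Complex.normSq l⁻¹ : ℂ) = l⁻¹ * star l⁻¹ := (Complex.mul_conj _).symm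
  -- Rotating the first frame gives the columns `l⁻¹ κ₂, -κ₁`; the screw motion with `exp (d / 2) =
  -- l` turns these into the second frame.
  refine ⟨2 * Complex.log l, ⟨_, m₁⟩, ⟨_, m₂⟩, ?_, ?_, ?_⟩
  · refine onGeodesic_of_coe_eq h₁.1 h₂.1 one_pos hp fun i j => ?_
    rw [hn, coe_basepoint]
    fin_cases i <;> fin_cases j <;>
      simp [linAct, ofCols, Matrix.mul_apply, Fin.sum_univ_two] <;> ring
  · refine onGeodesic_of_coe_eq h₁.1 h₂.1 hp one_pos fun i j => ?_
    rw [hn, coe_basepoint]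
    fin_cases i <;> fin_cases j <;>
      simp [linAct, ofCols, Matrix.mul_apply, Fin.sum_univ_two] <;> ring
  · rw [IsComplexDistance, D₁.inward_eq, o₁, o₂]
    apply Subtype.ext
    have e₁ : Complex.exp (2 * Complex.log l / 2) = l := by
      rw [mul_div_cancel_left₀ _ two_ne_zero, Complex.exp_log h]
    have e₂ : Complex.exp (-(2 * Complex.log l) / 2) = l⁻¹ := by
      rw [neg_div, Complex.exp_neg, e₁]
    have hs : (screwFirst (2 * Complex.log l)).1 = !![l, 0; 0, l⁻¹] := by
      change !![_, _; _, _] = _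
      rw [e₁, e₂]
    change _ = (ofCols _ _ d₁).1 * (rotSecond Real.pi).1 * (screwFirst (2 * Complex.log l)).1
    rw [hs, coe_rotSecond_pi]
    ext i j
    fin_cases i <;> fin_cases j <;>
      simp [ofCols, Matrix.mul_apply, Fin.sum_univ_two] <;> field_simp

/-- The lambda length is the determinant of the spinors. -/
theorem lambdaLength_eq {D₁ D₂ : SpinDecoratedHorosphere} {κ₁ κ₂ : Fin 2 → ℂ}
    (h₁ : CorrespondsTo D₁ κ₁) (h₂ : CorrespondsTo D₂ κ₂) :
    lambdaLength D₁ D₂ = spinorDet κ₁ κ₂ := by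
  rw [lambdaLength]
  split_ifs with h
  · exact h.choose_spec.exp_eq h₁ h₂
  -- Without a distance the lambda length has its default value 0, and a nonzero determinant would
  -- supply a distance.
  · by_contra h0
    exact h (exists_isHorosphereDistance h₁ h₂ (Ne.symm h0))

/-! ### Spin isometries -/

theorem maps_iff {A : SL2C} {D D' : SpinDecoratedHorosphere} {κ μ : Fin 2 → ℂ}
    (h : CorrespondsTo D κ) (h' : CorrespondsTo D' μ) :
    Maps A D D' ↔ μ = (A : Mat2).mulVec κ := by
  constructor
  · rintro ⟨hn, hm⟩
    obtain ⟨S, hS⟩ := D.horosphere_nonempty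
    have hS' : A • S ∈ horosphere D'.normal := by
      rw [hn]; exact smul_mem_horosphere hS
    have := (hm ⟨S, hS⟩ ⟨_, hS'⟩ rfl).2
    rw [← h.2 ⟨S, hS⟩, ← h'.2 ⟨_, hS'⟩, this, Matrix.SpecialLinearGroup.coe_mul,
      Matrix.mulVec_mulVec]
  · intro hμ
    refine ⟨?_, fun S S' hS => ?_⟩
    · rw [h'.1, h.1, hμ]; exact (linAct_spinorNormal A κ).symm
    · have ho : D'.outward S' = A * D.outward S := by
        apply spinFrame_ext
        · rw [D'.basepoint_outward, basepoint_mul, D.basepoint_outward, hS]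
        · rw [h'.2, hμ, Matrix.SpecialLinearGroup.coe_mul, ← Matrix.mulVec_mulVec, h.2]
      exact ⟨by rw [D'.inward_eq, D.inward_eq, ho, mul_assoc], ho⟩

/-! ### Real spinors -/

/-- A real vector as a spinor. -/
def realSpinor (v : Fin 2 → ℝ) : Fin 2 → ℂ := fun i => (v i : ℂ)

theorem realSpinor_injective : Function.Injective realSpinor := fun _ _ h =>
  funext fun i => Complex.ofReal_injective (congrFun h i)

theorem realSpinor_ne_zero {v : Fin 2 → ℝ} (h : v ≠ 0) : realSpinor v ≠ 0 := fun h' =>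
  h (realSpinor_injective (h'.trans (by ext; simp [realSpinor])))

/-- The determinant of two real vectors. -/
def realDet (v w : Fin 2 → ℝ) : ℝ := v 0 * w 1 - v 1 * w 0

theorem spinorDet_realSpinor (v w : Fin 2 → ℝ) :
    spinorDet (realSpinor v) (realSpinor w) = realDet v w := by
  simp [spinorDet, realDet, realSpinor]

theorem toSL2C_mulVec (A : SL2R) (v : Fin 2 → ℝ) :
    (toSL2C A : Mat2).mulVec (realSpinor v) = realSpinor (A.1.mulVec v) := by
  ext i
  simp [realSpinor, toSL2C, Matrix.mulVec, dotProduct, Fin.sum_univ_two]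

theorem linAct_eY_eq_of_real {W : SL2C} (h : ∀ i j, star (W.1 i j) = W.1 i j) :
    linAct W eY = eY := by
  have hd := W.2
  rw [Matrix.det_fin_two] at hd
  have h' : ∀ i j, (starRingEnd ℂ) (W.1 i j) = W.1 i j := h
  ext i j
  fin_cases i <;> fin_cases j <;>
    simp [linAct, eY, Matrix.mul_apply, Fin.sum_univ_two, h']
  · ring
  · linear_combination Complex.I * hd
  · linear_combination -Complex.I * hd
  · ring

/-- Every `W` of determinant 1 satisfies `W eY Wᵀ = eY`, so `W eY W* = eY` says that `W` equals its
complex conjugate. The proof solves the entrywise equations for the conjugates of the entries. -/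
theorem real_of_linAct_eY {W : SL2C} (h : linAct W eY = eY) :
    ∀ i j, star (W.1 i j) = W.1 i j := by
  have hd := W.2
  rw [Matrix.det_fin_two] at hd
  have hI := Complex.I_ne_zero
  have a := congrFun (congrFun h 0) 0
  have b := congrFun (congrFun h 0) 1
  have c := congrFun (congrFun h 1) 0
  have d := congrFun (congrFun h 1) 1
  simp [linAct, eY, Matrix.mul_apply, Fin.sum_univ_two] at a b c d
  rw [Fin.forall_fin_two, Fin.forall_fin_two, Fin.forall_fin_two]
  simp only [RCLike.star_def]
  generalize (starRingEnd ℂ) (W.1 0 0) = p at *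
  generalize (starRingEnd ℂ) (W.1 0 1) = q at *
  generalize (starRingEnd ℂ) (W.1 1 0) = r at *
  generalize (starRingEnd ℂ) (W.1 1 1) = s at *
  replace a : W.1 0 0 * q = W.1 0 1 * p :=
    mul_left_cancel₀ hI (by linear_combination a)
  replace b : W.1 0 0 * s - W.1 0 1 * r = 1 :=
    mul_left_cancel₀ hI (by linear_combination b)
  replace c : W.1 1 1 * p - W.1 1 0 * q = 1 :=
    mul_left_cancel₀ hI (by linear_combination -c)
  replace d : W.1 1 0 * s = W.1 1 1 * r :=
    mul_left_cancel₀ hI (by linear_combination d)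
  refine ⟨⟨?_, ?_⟩, ?_, ?_⟩
  · linear_combination -p * hd + W.1 0 0 * c + W.1 1 0 * a
  · linear_combination -q * hd + W.1 0 1 * c + W.1 1 1 * a
  · linear_combination -r * hd + W.1 1 0 * b - W.1 0 0 * d
  · linear_combination -s * hd + W.1 1 1 * b - W.1 0 1 * d

/-! ### Horocycles of real spinors -/

theorem mink_plane_spinorNormal (z : UpperHalfPlane) (v : Fin 2 → ℝ) :
    mink (plane z).1 (spinorNormal (realSpinor v)) =
      ((z.re * v 1 - v 0) ^ 2 + z.im ^ 2 * v 1 ^ 2) / z.im := by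
  rw [mink_apply]
  simp [plane, planeMatrix, spinorNormal, realSpinor, Matrix.vecMulVec_apply]
  simp only [← Complex.ofReal_pow, Complex.ofReal_re]
  have := z.im_ne_zero
  field_simp
  ring

theorem plane_mem_horosphere_iff (z : UpperHalfPlane) (v : Fin 2 → ℝ) :
    plane z ∈ horosphere (spinorNormal (realSpinor v)) ↔
      (z.re * v 1 - v 0) ^ 2 + z.im ^ 2 * v 1 ^ 2 = z.im := by
  change mink _ _ = 1 ↔ _
  rw [mink_plane_spinorNormal, div_eq_one_iff_eq z.im_ne_zero]

/-- The boundary point `v 0 / v 1` of the hyperbolic plane. -/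
def idealPoint (v : Fin 2 → ℝ) : OnePoint ℝ :=
  if v 1 = 0 then OnePoint.infty else ((v 0 / v 1 : ℝ) : OnePoint ℝ)

/-- The Euclidean size of the horocycle of a real spinor. -/
def horocycleSize (v : Fin 2 → ℝ) : ℝ := if v 1 = 0 then v 0 ^ 2 else (v 1 ^ 2)⁻¹

/-- Normal forms that separate the ideal point from the scale of the vector, for the case analyses
on determinants and cyclic order. -/
theorem idealPoint_cases {v : Fin 2 → ℝ} (hv : v ≠ 0) :
    (∃ t : ℝ, t ≠ 0 ∧ v = ![t, 0] ∧ idealPoint v = OnePoint.infty) ∨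
    (∃ t a : ℝ, t ≠ 0 ∧ v = ![a * t, t] ∧ idealPoint v = (a : OnePoint ℝ)) := by
  by_cases h : v 1 = 0
  · left
    refine ⟨v 0, fun h0 => hv ?_, ?_, ?_⟩
    · ext i; fin_cases i <;> assumption
    · ext i; fin_cases i <;> simp [h]
    · simp [idealPoint, h]
  · right
    refine ⟨v 1, v 0 / v 1, h, ?_, ?_⟩
    · ext i; fin_cases i <;> simp [h]
    · simp [idealPoint, h]

theorem horocycleSize_pos {v : Fin 2 → ℝ} (hv : v ≠ 0) : 0 < horocycleSize v := by
  unfold horocycleSize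
  split_ifs with h
  · have : v 0 ≠ 0 := fun h0 => hv (by ext i; fin_cases i <;> assumption)
    positivity
  · positivity

theorem plane_preimage_horosphere (v : Fin 2 → ℝ) :
    plane ⁻¹' horosphere (spinorNormal (realSpinor v)) =
      horocycle (idealPoint v) (horocycleSize v) := by
  ext z
  rw [Set.mem_preimage, plane_mem_horosphere_iff]
  unfold idealPoint horocycleSize
  split_ifs with h
  · change _ ↔ z.im = v 0 ^ 2
    rw [h]
    constructor <;> intro h <;> linarith
  · change _ ↔ (z.re - v 0 / v 1) ^ 2 + z.im ^ 2 = (v 1 ^ 2)⁻¹ * z.im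
    field_simp

theorem isHorocycle_plane_preimage {v : Fin 2 → ℝ} (hv : v ≠ 0) :
    IsHorocycle (idealPoint v) (plane ⁻¹' horosphere (spinorNormal (realSpinor v))) :=
  ⟨_, horocycleSize_pos hv, plane_preimage_horosphere v⟩

theorem mem_horocycle_infty {r : ℝ} {z : UpperHalfPlane} :
    z ∈ horocycle OnePoint.infty r ↔ z.im = r := Iff.rfl

theorem mem_horocycle_coe {x r : ℝ} {z : UpperHalfPlane} :
    z ∈ horocycle (x : OnePoint ℝ) r ↔ (z.re - x) ^ 2 + z.im ^ 2 = r * z.im := Iff.rfl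

/-- At a given height, the equation of a circle tangent at `x` fixes the distance of the real part
from `x`; a horizontal line contains points at distances 0 and 1. -/
theorem horocycle_infty_ne_coe {x r r' : ℝ} (hr : 0 < r) :
    horocycle OnePoint.infty r ≠ horocycle (x : OnePoint ℝ) r' := by
  intro h
  have h1 : (⟨⟨x, r⟩, hr⟩ : UpperHalfPlane) ∈ horocycle (x : OnePoint ℝ) r' := by
    rw [← h]; exact mem_horocycle_infty.mpr rfl
  have h2 : (⟨⟨x + 1, r⟩, hr⟩ : UpperHalfPlane) ∈ horocycle (x : OnePoint ℝ) r' := by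
    rw [← h]; exact mem_horocycle_infty.mpr rfl
  rw [mem_horocycle_coe] at h1 h2
  change (x - x) ^ 2 + r ^ 2 = r' * r at h1
  change (x + 1 - x) ^ 2 + r ^ 2 = r' * r at h2
  linarith

theorem horocycle_center_unique {p p' : OnePoint ℝ} {r r' : ℝ} (hr : 0 < r) (hr' : 0 < r')
    (h : horocycle p r = horocycle p' r') : p = p' := by
  induction p using OnePoint.rec with
  | infty =>
    induction p' using OnePoint.rec with
    | infty => rfl
    | coe x => exact absurd h (horocycle_infty_ne_coe hr)
  | coe x =>
    induction p' using OnePoint.rec with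
    | infty => exact absurd h.symm (horocycle_infty_ne_coe hr')
    | coe x' =>
      -- The rightmost and leftmost points of the circle: subtracting their equations shows that
      -- both circles have the same axis of symmetry.
      have h1 : (⟨⟨x + r / 2, r / 2⟩, half_pos hr⟩ : UpperHalfPlane) ∈ horocycle x' r' := by
        rw [← h, mem_horocycle_coe]
        change (x + r / 2 - x) ^ 2 + (r / 2) ^ 2 = r * (r / 2)
        ring
      have h2 : (⟨⟨x - r / 2, r / 2⟩, half_pos hr⟩ : UpperHalfPlane) ∈ horocycle x' r' := by
        rw [← h, mem_horocycle_coe]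
        change (x - r / 2 - x) ^ 2 + (r / 2) ^ 2 = r * (r / 2)
        ring
      rw [mem_horocycle_coe] at h1 h2
      change (x + r / 2 - x') ^ 2 + (r / 2) ^ 2 = r' * (r / 2) at h1
      change (x - r / 2 - x') ^ 2 + (r / 2) ^ 2 = r' * (r / 2) at h2
      have h3 : r * (x - x') = 0 := by linear_combination (h1 - h2) / 2
      rcases mul_eq_zero.mp h3 with h3 | h3
      · exact absurd h3 hr.ne'
      · rw [sub_eq_zero.mp h3]

theorem horocycle_nonempty (p : OnePoint ℝ) {r : ℝ} (hr : 0 < r) : (horocycle p r).Nonempty := by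
  induction p using OnePoint.rec with
  | infty => exact ⟨⟨⟨0, r⟩, hr⟩, rfl⟩
  | coe x =>
    refine ⟨⟨⟨x, r⟩, hr⟩, ?_⟩
    rw [mem_horocycle_coe]
    change (x - x) ^ 2 + r ^ 2 = r * r
    ring

theorem exists_idealPoint_eq (p : OnePoint ℝ) {r : ℝ} (hr : 0 < r) :
    ∃ v : Fin 2 → ℝ, v ≠ 0 ∧ idealPoint v = p ∧ horocycleSize v = r := by
  have hs : √r ≠ 0 := by positivity
  have hsq := Real.sq_sqrt hr.le
  induction p using OnePoint.rec with
  | infty =>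
    refine ⟨![√r, 0], fun h => hs (congrFun h 0), by simp [idealPoint], ?_⟩
    simp [horocycleSize, hsq]
  | coe x =>
    refine ⟨![x / √r, (√r)⁻¹], fun h => inv_ne_zero hs (congrFun h 1), ?_, ?_⟩
    · simp [idealPoint, hs]
    · simp [horocycleSize, hs, hsq]

/-! ### Cyclic order -/

theorem realDet_eq_zero_iff {v w : Fin 2 → ℝ} (hv : v ≠ 0) (hw : w ≠ 0) :
    realDet v w = 0 ↔ idealPoint v = idealPoint w := by
  rcases idealPoint_cases hv with ⟨t, ht, rfl, e⟩ | ⟨t, a, ht, rfl, e⟩ <;>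
  rcases idealPoint_cases hw with ⟨s, hs, rfl, e'⟩ | ⟨s, b, hs, rfl, e'⟩ <;>
  rw [e, e']
  · simp [realDet]
  · simp [realDet, ht, hs]
  · simp [realDet, ht, hs]
  · rw [OnePoint.coe_eq_coe, show realDet ![a * t, t] ![b * s, s] = (t * s) * (a - b) by
      simp [realDet]; ring, mul_eq_zero_iff_left (mul_ne_zero ht hs), sub_eq_zero]

theorem cyclic_real_iff (a b c : ℝ) :
    ((b < a ∧ c < b) ∨ (c < b ∧ a < c) ∨ (a < c ∧ b < a)) ↔ 0 < (a - b) * (b - c) * (a - c) := by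
  constructor
  · rintro (⟨h1, h2⟩ | ⟨h1, h2⟩ | ⟨h1, h2⟩)
    · exact mul_pos (mul_pos (by linarith) (by linarith)) (by linarith)
    · exact mul_pos_of_neg_of_neg (mul_neg_of_neg_of_pos (by linarith) (by linarith)) (by linarith)
    · exact mul_pos_of_neg_of_neg (mul_neg_of_pos_of_neg (by linarith) (by linarith)) (by linarith)
  · intro h
    by_contra! hn
    obtain ⟨n1, n2, n3⟩ := hn
    apply h.not_ge
    rcases lt_or_ge b a with hba | hba
    · have h1 := n1 hba
      have h2 : c ≤ a := by
        by_contra! h'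
        exact absurd (n3 h') (not_le.mpr hba)
      exact mul_nonpos_of_nonpos_of_nonneg
        (mul_nonpos_of_nonneg_of_nonpos (by linarith) (by linarith)) (by linarith)
    · rcases lt_or_ge c b with hcb | hcb
      · have h1 := n2 hcb
        exact mul_nonpos_of_nonpos_of_nonneg
          (mul_nonpos_of_nonpos_of_nonneg (by linarith) (by linarith)) (by linarith)
      · exact mul_nonpos_of_nonneg_of_nonpos
          (mul_nonneg_of_nonpos_of_nonpos (by linarith) (by linarith)) (by linarith)

theorem height_infty : height OnePoint.infty = ⊤ := rfl

theorem height_coe (x : ℝ) : height (x : OnePoint ℝ) = (x : WithTop ℝ) := rfl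

/-- The product is quadratic in each vector, so it ignores signs and its own sign depends only on
the ideal points. For finite points `a, b, c` it is a positive square times `(a - b) (b - c) (a -
c)`; for a single point at infinity only the difference of the other two remains. -/
theorem cyclicTriple_idealPoint_iff {u v w : Fin 2 → ℝ} (hu : u ≠ 0) (hv : v ≠ 0) (hw : w ≠ 0) :
    CyclicTriple (idealPoint u) (idealPoint v) (idealPoint w) ↔
      0 < realDet u v * realDet v w * realDet u w := by
  rcases idealPoint_cases hu with ⟨t, ht, rfl, e⟩ | ⟨t, a, ht, rfl, e⟩ <;>
  rcases idealPoint_cases hv with ⟨s, hs, rfl, e'⟩ | ⟨s, b, hs, rfl, e'⟩ <;>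
  rcases idealPoint_cases hw with ⟨r, hr, rfl, e''⟩ | ⟨r, c, hr, rfl, e''⟩ <;>
  rw [e, e', e'', CyclicTriple] <;>
  simp only [height_infty, height_coe, WithTop.coe_lt_coe, WithTop.coe_lt_top, not_top_lt,
    lt_irrefl, and_false, and_true, true_and, or_false, false_or] <;>
  have hp : 0 < (t * s * r) ^ 2 := by positivity
  · simp [realDet]
  · simp [realDet]
  · simp [realDet]
  · rw [show realDet ![t, 0] ![b * s, s] * realDet ![b * s, s] ![c * r, r] *
      realDet ![t, 0] ![c * r, r] = (t * s * r) ^ 2 * (b - c) by simp [realDet]; ring,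
      mul_pos_iff_of_pos_left hp, sub_pos]
  · simp [realDet]
  · rw [show realDet ![a * t, t] ![s, 0] * realDet ![s, 0] ![c * r, r] *
      realDet ![a * t, t] ![c * r, r] = (t * s * r) ^ 2 * (c - a) by simp [realDet]; ring,
      mul_pos_iff_of_pos_left hp, sub_pos]
  · rw [show realDet ![a * t, t] ![b * s, s] * realDet ![b * s, s] ![r, 0] *
      realDet ![a * t, t] ![r, 0] = (t * s * r) ^ 2 * (a - b) by simp [realDet]; ring,
      mul_pos_iff_of_pos_left hp, sub_pos]
  · rw [show realDet ![a * t, t] ![b * s, s] * realDet ![b * s, s] ![c * r, r] *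
      realDet ![a * t, t] ![c * r, r] = (t * s * r) ^ 2 * ((a - b) * (b - c) * (a - c)) by
        simp [realDet]; ring,
      mul_pos_iff_of_pos_left hp, cyclic_real_iff]

/-! ### Planar decorations -/

/-- At a point of the plane both the basepoint and the spinor are real, so the outward frame and its
complex conjugate agree by `spinFrame_ext`. The frame is then a real matrix and fixes `eY`. -/
theorem isPlanar_of_realSpinor {D : SpinDecoratedHorosphere} {v : Fin 2 → ℝ}
    (h : CorrespondsTo D (realSpinor v)) :
    IsPlanarSpinDecoration (plane ⁻¹' horosphere (spinorNormal (realSpinor v))) D := by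
  refine ⟨by rw [h.1]; rfl, fun z hz => ?_⟩
  have hr : SpinFrame.frame (D.outward ⟨plane z, hz⟩) 1 = eY := by
    apply linAct_eY_eq_of_real
    have hb := D.basepoint_outward ⟨plane z, hz⟩
    have hk := h.2 ⟨plane z, hz⟩
    generalize D.outward ⟨plane z, hz⟩ = W at *
    have key : Matrix.SpecialLinearGroup.map (starRingEnd ℂ) W = W := by
      apply spinFrame_ext
      · rw [hb]
        apply Subtype.ext
        ext i j
        have e := congrFun (congrFun (congrArg Subtype.val hb) i) j
        have e' : star ((plane z).1 i j) = (plane z).1 i j := by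
          fin_cases i <;> fin_cases j <;> simp [plane, planeMatrix]
        rw [← e', ← e, coe_basepoint, coe_basepoint]
        simp [linAct, Matrix.mul_apply]
      · rw [hk]
        rw [mulVec_e1] at hk ⊢
        ext i
        have e : W.1 i 0 = realSpinor v i := congrFun hk i
        change star (W.1 i 0) = _
        rw [e]
        exact Complex.conj_ofReal _
    intro i j
    exact congrFun (congrFun (congrArg Subtype.val key) i) j
  exact ⟨by rw [D.inward_eq, frame_one_mul_rot, hr], hr⟩

/-- One point of the horocycle suffices: the outward frame there fixes `eY`, so it is real, and the
spinor is its first column. -/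
theorem exists_realSpinor_of_isPlanar {D : SpinDecoratedHorosphere} {c : Set UpperHalfPlane}
    (hc : c.Nonempty) (h : IsPlanarSpinDecoration c D) :
    ∃ v : Fin 2 → ℝ, v ≠ 0 ∧ CorrespondsTo D (realSpinor v) := by
  obtain ⟨κ, hκ, hD⟩ := exists_spinor D
  obtain ⟨z, hz⟩ := hc
  rw [← h.1] at hz
  have hr := real_of_linAct_eY (h.2 z hz).2
  have hk : realSpinor (fun i => (κ i).re) = κ := by
    ext i
    rw [← hD.2 ⟨plane z, hz⟩, mulVec_e1]
    exact Complex.conj_eq_iff_re.mp (hr i 0)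
  refine ⟨fun i => (κ i).re, ?_, by rwa [hk]⟩
  intro h0
  apply hκ
  rw [← hk, h0]
  ext i
  simp [realSpinor]

/-! ### The hyperbolic plane -/

theorem plane_smul (A : SL2R) (z : UpperHalfPlane) : plane (A • z) = toSL2C A • plane z := by
  have hy := z.im_pos
  have hzd : (A • z : UpperHalfPlane) * ((A.1 1 0 : ℂ) * z + (A.1 1 1 : ℂ)) =
      (A.1 0 0 : ℂ) * z + (A.1 0 1 : ℂ) := by
    have hd : (A.1 1 0 : ℂ) * z + (A.1 1 1 : ℂ) ≠ 0 := UpperHalfPlane.denom_ne_zero A z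
    rw [UpperHalfPlane.coe_specialLinearGroup_apply]
    exact div_mul_cancel₀ _ hd
  have h1 := congrArg Complex.re hzd
  have h2 := congrArg Complex.im hzd
  simp at h1 h2
  have hd := A.2
  rw [Matrix.det_fin_two] at hd
  have hy' := (A • z).im_pos
  generalize hz' : A • z = z' at *
  set x := z.re
  set y := z.im
  set x' := z'.re
  set y' := z'.im
  -- Here `N` is `|c z + d|²`, the factor by which the Möbius map divides the imaginary part.
  generalize hN : (A.1 1 0 * x + A.1 1 1) ^ 2 + (A.1 1 0 * y) ^ 2 = N
  have e : y' * N = y := by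
    rw [← hN]
    linear_combination (A.1 1 0 * x + A.1 1 1) * h2 - A.1 1 0 * y * h1 + y * hd
  have e01 : x' * N = (A.1 0 0 * x + A.1 0 1) * (A.1 1 0 * x + A.1 1 1) +
      A.1 0 0 * A.1 1 0 * y ^ 2 := by
    rw [← hN]
    linear_combination (A.1 1 0 * x + A.1 1 1) * h1 + A.1 1 0 * y * h2
  have e00 : (x' ^ 2 + y' ^ 2) * N = (A.1 0 0 * x + A.1 0 1) ^ 2 + (A.1 0 0 * y) ^ 2 := by
    rw [← hN, ← h1, ← h2]
    ring
  have hinv : y'⁻¹ = N * y⁻¹ := by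
    have hN0 : N ≠ 0 := fun h => hy.ne' (by rw [← e, h, mul_zero])
    rw [← e]
    field_simp
  apply Subtype.ext
  change planeMatrix z' = linAct (toSL2C A) (planeMatrix z)
  rw [planeMatrix, planeMatrix]
  change ((y'⁻¹ : ℝ) : ℂ) • !![((x' ^ 2 + y' ^ 2 : ℝ) : ℂ), (x' : ℂ); (x' : ℂ), 1] =
    linAct (toSL2C A) (((y⁻¹ : ℝ) : ℂ) • !![((x ^ 2 + y ^ 2 : ℝ) : ℂ), (x : ℂ); (x : ℂ), 1])
  rw [hinv]
  have c00 := congrArg Complex.ofReal e00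
  have c01 := congrArg Complex.ofReal e01
  have c11 := congrArg Complex.ofReal hN
  push_cast at c00 c01 c11
  ext i j
  fin_cases i <;> fin_cases j <;>
    simp [linAct, toSL2C, Matrix.mul_apply, Fin.sum_univ_two]
  · linear_combination (y : ℂ)⁻¹ * c00
  · linear_combination (y : ℂ)⁻¹ * c01
  · linear_combination (y : ℂ)⁻¹ * c01
  · linear_combination -(y : ℂ)⁻¹ * c11

/-! ### Isometries of the plane preserve squared lambda lengths -/

theorem mink_plane_eq_cosh_dist (z w : UpperHalfPlane) :
    mink (plane z).1 (plane w).1 = Real.cosh (dist z w) := by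
  rw [UpperHalfPlane.cosh_dist, mink_apply, Complex.dist_eq_re_im, Real.sq_sqrt (by positivity)]
  simp [plane, planeMatrix]
  simp only [← Complex.ofReal_pow, Complex.ofReal_re]
  have := z.im_ne_zero
  have := w.im_ne_zero
  field_simp
  ring

theorem mink_spinorNormal_realSpinor (v w : Fin 2 → ℝ) :
    mink (spinorNormal (realSpinor v)) (spinorNormal (realSpinor w)) = 2 * realDet v w ^ 2 := by
  rw [mink_apply]
  simp [spinorNormal, realSpinor, Matrix.vecMulVec_apply, realDet]
  ring

/-- The coordinate on the standard horosphere is Euclidean: hyperbolic distance within it depends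
only on `|b - c|`. -/
theorem mink_basepoint_upper (b c : ℂ) :
    mink (linAct (upper b) 1) (linAct (upper c) 1) = 1 + Complex.normSq (b - c) / 2 := by
  rw [mink_apply, linAct_upper_one, linAct_upper_one]
  simp [Complex.normSq_apply]
  ring

/-- On a horosphere, a point and two points at opposite unit displacements from it determine the
normal. -/
theorem spinorNormal_eq_of_mink_eq {κ : Fin 2 → ℂ} (hκ : κ ≠ 0) {S₀ S₁ S₂ : H3}
    (h₀ : S₀ ∈ horosphere (spinorNormal κ)) (h₁ : S₁ ∈ horosphere (spinorNormal κ))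
    (h₂ : S₂ ∈ horosphere (spinorNormal κ)) (h01 : mink S₀.1 S₁.1 = 3 / 2)
    (h02 : mink S₀.1 S₂.1 = 3 / 2) (h12 : mink S₁.1 S₂.1 = 3) :
    spinorNormal κ = S₁.1 + S₂.1 - S₀.1 - S₀.1 := by
  obtain ⟨A, rfl⟩ := exists_mulVec_eq hκ
  have key : ∀ {S : H3}, S ∈ horosphere (spinorNormal ((A : Mat2).mulVec ![1, 0])) →
      ∃ c, S.1 = linAct A (linAct (upper c) 1) := by
    intro S hS
    refine ⟨(A⁻¹ • S : H3).1 0 1, ?_⟩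
    rw [← linAct_mul]
    exact congrArg Subtype.val (outwardFrame_basepoint rfl hS).symm
  obtain ⟨a, ha⟩ := key h₀
  obtain ⟨b, hb⟩ := key h₁
  obtain ⟨c, hc⟩ := key h₂
  rw [ha, hb, mink_linAct, mink_basepoint_upper] at h01
  rw [ha, hc, mink_linAct, mink_basepoint_upper] at h02
  rw [hb, hc, mink_linAct, mink_basepoint_upper] at h12
  -- In the coordinate of the horosphere, `b` and `c` are at distance 1 from `a` and 2 from each
  -- other, so by the parallelogram law `a` is their midpoint.
  have hs : Complex.normSq (b + c - 2 * a) = 0 := by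
    simp only [Complex.normSq_apply, Complex.sub_re, Complex.sub_im, Complex.add_re,
      Complex.add_im, Complex.mul_re, Complex.mul_im, Complex.re_ofNat, Complex.im_ofNat] at *
    linear_combination 4 * h01 + 4 * h02 - 2 * h12
  have hs' := Complex.normSq_eq_zero.mp hs
  have hn : Complex.normSq (b - a) = 1 := by
    rw [← Complex.normSq_neg, neg_sub]; linarith
  have hc' : c = 2 * a - b := by linear_combination hs'
  have hn' : (b - a) * star (b - a) = 1 := by
    have := Complex.mul_conj (b - a)
    rw [hn] at this
    simpa using this
  rw [← linAct_spinorNormal, ha, hb, hc]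
  -- The matrix `linAct (upper c) 1` is quadratic in `c`, with quadratic part `|c|²` in one corner.
  -- Its second difference over a unit step is twice that corner, which is the normal.
  have lin : spinorNormal ![1, 0] =
      linAct (upper b) 1 + linAct (upper c) 1 + - linAct (upper a) 1 + - linAct (upper a) 1 := by
    rw [← one_add_eZ, hc']
    simp only [linAct_upper_one]
    simp only [star_sub, star_mul'] at hn' ⊢
    ext i j
    fin_cases i <;> fin_cases j <;> simp [eZ] at hn' ⊢
    · linear_combination (-2 : ℂ) * hn'
    · ring
    · ring
  rw [lin]
  simp only [linAct_add, linAct_neg, sub_eq_add_neg]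

theorem exists_real_mulVec_eq {v : Fin 2 → ℝ} (h : v ≠ 0) :
    ∃ A : SL2R, A.1.mulVec ![1, 0] = v := by
  obtain ⟨A, h0, h1⟩ := (isCoprime_of_ne_zero h).exists_SL2_col 0
  refine ⟨A, ?_⟩
  ext i; fin_cases i <;> simpa [Matrix.mulVec, dotProduct, Fin.sum_univ_two]

theorem plane_add_I (x : ℝ) : (plane ⟨⟨x, 1⟩, one_pos⟩).1 = linAct (upper x) 1 := by
  rw [linAct_upper_one]
  have h1 : (⟨⟨x, 1⟩, one_pos⟩ : UpperHalfPlane).im = 1 := rfl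
  have h2 : (⟨⟨x, 1⟩, one_pos⟩ : UpperHalfPlane).re = x := rfl
  change planeMatrix _ = _
  rw [planeMatrix, h1, h2]
  ext i j
  fin_cases i <;> fin_cases j <;> simp
  ring

/-- A horocycle contains a point with two points at opposite unit displacements from it. -/
theorem exists_horocycle_points {v : Fin 2 → ℝ} (hv : v ≠ 0) : ∃ z₀ z₁ z₂ : UpperHalfPlane,
    plane z₀ ∈ horosphere (spinorNormal (realSpinor v)) ∧
    plane z₁ ∈ horosphere (spinorNormal (realSpinor v)) ∧
    plane z₂ ∈ horosphere (spinorNormal (realSpinor v)) ∧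
    mink (plane z₀).1 (plane z₁).1 = 3 / 2 ∧ mink (plane z₀).1 (plane z₂).1 = 3 / 2 ∧
    mink (plane z₁).1 (plane z₂).1 = 3 := by
  obtain ⟨A, hA⟩ := exists_real_mulVec_eq hv
  have hr : realSpinor ![1, 0] = ![1, 0] := by
    ext i; fin_cases i <;> simp [realSpinor]
  have hA' : (toSL2C A : Mat2).mulVec ![1, 0] = realSpinor v := by
    rw [← hr, toSL2C_mulVec, hA]
  have hm : ∀ x : ℝ, plane (A • ⟨⟨x, 1⟩, one_pos⟩) ∈ horosphere (spinorNormal (realSpinor v)) := by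
    intro x
    rw [plane_smul, ← hA', ← linAct_spinorNormal]
    apply smul_mem_horosphere
    have := mem_horosphere_of_mulVec (upper_mulVec x)
    convert this using 1
    exact Subtype.ext (plane_add_I x)
  have hd : ∀ x y : ℝ, mink (plane (A • ⟨⟨x, 1⟩, one_pos⟩)).1 (plane (A • ⟨⟨y, 1⟩, one_pos⟩)).1
      = 1 + (x - y) ^ 2 / 2 := by
    intro x y
    rw [plane_smul, plane_smul, coe_smul, coe_smul, mink_linAct, plane_add_I, plane_add_I,
      mink_basepoint_upper, ← Complex.ofReal_sub, Complex.normSq_ofReal]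
    ring
  -- The points 0, 1 and -1 of the horizontal line at height 1, moved by `A`.
  refine ⟨_, _, _, hm 0, hm 1, hm (-1), ?_, ?_, ?_⟩ <;> rw [hd] <;> norm_num

/-- An isometry that maps two horocycles to two others preserves the square of the lambda length. -/
theorem realDet_sq_eq_of_isometry {v w v' w' : Fin 2 → ℝ} (hv : v ≠ 0) (hw : w ≠ 0) (hv' : v' ≠ 0)
    (hw' : w' ≠ 0) (φ : UpperHalfPlane ≃ᵢ UpperHalfPlane)
    (h : φ '' (plane ⁻¹' horosphere (spinorNormal (realSpinor v))) =
      plane ⁻¹' horosphere (spinorNormal (realSpinor v')))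
    (h' : φ '' (plane ⁻¹' horosphere (spinorNormal (realSpinor w))) =
      plane ⁻¹' horosphere (spinorNormal (realSpinor w'))) :
    realDet v w ^ 2 = realDet v' w' ^ 2 := by
  have hφ : ∀ z z', mink (plane (φ z)).1 (plane (φ z')).1 = mink (plane z).1 (plane z').1 := by
    intro z z'
    rw [mink_plane_eq_cosh_dist, mink_plane_eq_cosh_dist, φ.isometry.dist_eq]
  -- Distances alone single out the three points whose combination is the normal, so the same
  -- combination of their images under `φ` is the normal of the image horocycle.
  have key : ∀ {v v' : Fin 2 → ℝ}, v ≠ 0 → v' ≠ 0 →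
      φ '' (plane ⁻¹' horosphere (spinorNormal (realSpinor v))) =
      plane ⁻¹' horosphere (spinorNormal (realSpinor v')) →
      ∃ z₀ z₁ z₂,
        spinorNormal (realSpinor v) =
          (plane z₁).1 + (plane z₂).1 - (plane z₀).1 - (plane z₀).1 ∧
        spinorNormal (realSpinor v') =
          (plane (φ z₁)).1 + (plane (φ z₂)).1 - (plane (φ z₀)).1 - (plane (φ z₀)).1 := by
    intro v v' hv hv' h
    obtain ⟨z₀, z₁, z₂, h₀, h₁, h₂, h01, h02, h12⟩ := exists_horocycle_points hv
    have him : ∀ z, plane z ∈ horosphere (spinorNormal (realSpinor v)) →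
        plane (φ z) ∈ horosphere (spinorNormal (realSpinor v')) := by
      intro z hz
      have := Set.mem_image_of_mem φ (Set.mem_preimage.mpr hz)
      rwa [h] at this
    exact ⟨z₀, z₁, z₂,
      spinorNormal_eq_of_mink_eq (realSpinor_ne_zero hv) h₀ h₁ h₂ h01 h02 h12,
      spinorNormal_eq_of_mink_eq (realSpinor_ne_zero hv') (him _ h₀) (him _ h₁) (him _ h₂)
        (by rw [hφ, h01]) (by rw [hφ, h02]) (by rw [hφ, h12])⟩
  obtain ⟨z₀, z₁, z₂, e, e'⟩ := key hv hv' h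
  obtain ⟨w₀, w₁, w₂, f, f'⟩ := key hw hw' h'
  have := mink_spinorNormal_realSpinor v w
  have := mink_spinorNormal_realSpinor v' w'
  have : mink (spinorNormal (realSpinor v)) (spinorNormal (realSpinor w)) =
      mink (spinorNormal (realSpinor v')) (spinorNormal (realSpinor w')) := by
    rw [e, e', f, f']
    simp only [mink_add_left, mink_sub_left, mink_add_right, mink_sub_right, hφ]
  linarith

/-! ### Positive matrices and spin-coherent polygons -/

theorem realDet_swap (v w : Fin 2 → ℝ) : realDet w v = -realDet v w := by
  unfold realDet; ring

theorem realDet_ne_zero_left {v w : Fin 2 → ℝ} (h : realDet v w ≠ 0) : v ≠ 0 := by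
  rintro rfl; exact h (by simp [realDet])

theorem realDet_ne_zero_right {v w : Fin 2 → ℝ} (h : realDet v w ≠ 0) : w ≠ 0 := by
  rintro rfl; exact h (by simp [realDet])

theorem exists_isometry_maps {A : SL2R} {v w : Fin 2 → ℝ} (h : A.1.mulVec v = w) :
    IsometryEquiv.constSMul A '' (plane ⁻¹' horosphere (spinorNormal (realSpinor v))) =
      plane ⁻¹' horosphere (spinorNormal (realSpinor w)) := by
  rw [← IsometryEquiv.preimage_symm, IsometryEquiv.constSMul_symm]
  ext z
  change mink (plane (A⁻¹ • z)).1 _ = 1 ↔ mink (plane z).1 _ = 1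
  rw [← h, ← toSL2C_mulVec, ← linAct_spinorNormal, plane_smul, coe_smul, map_inv,
    ← mink_linAct (toSL2C A), linAct_linAct_inv]

namespace PositiveMatrix
variable {d : ℕ} (M : PositiveMatrix d)

/-- Column `i` of a real matrix. -/
def column (i : Fin d) : Fin 2 → ℝ := fun k => M.1 k i

theorem realDet_column_pos {i j : Fin d} (h : i < j) : 0 < realDet (column M i) (column M j) := by
  have := M.2 i j h
  rw [Matrix.det_fin_two] at this
  simp at this
  simp only [realDet, column]
  linarith

/-- Each column has a nonzero minor with some other column, which exists because `2 ≤ d`. -/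
theorem column_ne_zero (hd : 2 ≤ d) (i : Fin d) : column M i ≠ 0 := by
  have : Nontrivial (Fin d) := Fin.nontrivial_iff_two_le.mpr hd
  obtain ⟨j, hj⟩ := exists_ne i
  rcases lt_or_gt_of_ne hj with h | h
  · exact realDet_ne_zero_right (realDet_column_pos M h).ne'
  · exact realDet_ne_zero_left (realDet_column_pos M h).ne'

/-- The positive matrix with given columns. -/
def ofColumns (v : Fin d → Fin 2 → ℝ) (h : ∀ i j, i < j → 0 < realDet (v i) (v j)) :
    PositiveMatrix d :=
  ⟨Matrix.of fun k i => v i k, fun i j hij => by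
    have := h i j hij
    rw [realDet] at this
    rw [Matrix.det_fin_two]
    simp
    linarith⟩

theorem inOrder (hd : 2 ≤ d) : InOrder fun i => idealPoint (column M i) := by
  refine ⟨fun i j hij => ?_, fun i j k hij hjk => ?_⟩
  · have h0 := (realDet_eq_zero_iff (column_ne_zero M hd i) (column_ne_zero M hd j)).mpr hij
    rcases lt_trichotomy i j with h | h | h
    · exact absurd h0 (realDet_column_pos M h).ne'
    · exact h
    · rw [realDet_swap, neg_eq_zero] at h0
      exact absurd h0 (realDet_column_pos M h).ne'
  · rw [cyclicTriple_idealPoint_iff (column_ne_zero M hd i) (column_ne_zero M hd j)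
      (column_ne_zero M hd k)]
    exact mul_pos (mul_pos (realDet_column_pos M hij) (realDet_column_pos M hjk))
      (realDet_column_pos M (hij.trans hjk))

/-- The spin-decorated horosphere of a column. -/
def decoration (hd : 2 ≤ d) (i : Fin d) : SpinDecoratedHorosphere :=
  (exists_correspondsTo (realSpinor_ne_zero (column_ne_zero M hd i))).choose

theorem correspondsTo_decoration (hd : 2 ≤ d) (i : Fin d) :
    CorrespondsTo (decoration M hd i) (realSpinor (column M i)) :=
  (exists_correspondsTo (realSpinor_ne_zero (column_ne_zero M hd i))).choose_spec

/-- The spin-coherent ideal polygon of the columns of a positive matrix. -/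
def gon (hd : 2 ≤ d) : SpinCoherentGon d where
  vertex i := idealPoint (column M i)
  inOrder := inOrder M hd
  horocycle i := plane ⁻¹' horosphere (spinorNormal (realSpinor (column M i)))
  isHorocycle i := isHorocycle_plane_preimage (column_ne_zero M hd i)
  decoration := decoration M hd
  planar i := isPlanar_of_realSpinor (correspondsTo_decoration M hd i)
  coherent_lt i j h := ⟨_, realDet_column_pos M h, by
    rw [lambdaLength_eq (correspondsTo_decoration M hd i) (correspondsTo_decoration M hd j),
      spinorDet_realSpinor]⟩
  coherent_gt i j h := ⟨_, neg_neg_iff_pos.mpr (realDet_column_pos M h), by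
    rw [lambdaLength_eq (correspondsTo_decoration M hd i) (correspondsTo_decoration M hd j),
      spinorDet_realSpinor, realDet_swap]⟩

theorem gon_injective (hd : 2 ≤ d) : Function.Injective fun M : PositiveMatrix d => gon M hd := by
  intro M N h
  have hc : ∀ i, column M i = column N i := by
    intro i
    have h' : decoration M hd i = decoration N hd i :=
      congrArg (fun X : SpinCoherentGon d => X.decoration i) h
    have hM := correspondsTo_decoration M hd i
    rw [h'] at hM
    exact realSpinor_injective (hM.unique (correspondsTo_decoration N hd i))
  apply Subtype.ext
  ext k i
  exact congrFun (hc i) k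

/-- Planarity gives real spinors and coherence makes their minors positive. The vertices are
recovered because a horocycle determines its centre. -/
theorem gon_surjective (hd : 2 ≤ d) : Function.Surjective fun M : PositiveMatrix d => gon M hd := by
  intro X
  have hne : ∀ i, (X.horocycle i).Nonempty := by
    intro i
    obtain ⟨r, hr, h⟩ := X.isHorocycle i
    rw [h]
    exact horocycle_nonempty _ hr
  choose v hv hD using fun i => exists_realSpinor_of_isPlanar (hne i) (X.planar i)
  have hpos : ∀ i j, i < j → 0 < realDet (v i) (v j) := by
    intro i j hij
    obtain ⟨r, hr, h⟩ := X.coherent_lt i j hij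
    rw [lambdaLength_eq (hD i) (hD j), spinorDet_realSpinor] at h
    rwa [Complex.ofReal_injective h]
  refine ⟨ofColumns v hpos, ?_⟩
  have hhor : ∀ i, plane ⁻¹' horosphere (spinorNormal (realSpinor (v i))) = X.horocycle i := by
    intro i
    rw [← (X.planar i).1, (hD i).1]
    rfl
  have hvert : ∀ i, idealPoint (v i) = X.vertex i := by
    intro i
    obtain ⟨r, hr, h⟩ := X.isHorocycle i
    apply horocycle_center_unique (horocycleSize_pos (hv i)) hr
    rw [← plane_preimage_horosphere, hhor, h]
  have hdec : ∀ i, decoration (ofColumns v hpos) hd i = X.decoration i := fun i =>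
    correspondsTo_ext (correspondsTo_decoration _ hd i) (hD i)
  obtain ⟨⟨p, _, c, _⟩, D, _, _, _⟩ := X
  simp only [gon, SpinCoherentGon.mk.injEq, DecoratedIdealGon.mk.injEq]
  exact ⟨⟨funext hvert, funext hhor⟩, funext hdec⟩

theorem mapsSpinGon_gon_iff (hd : 2 ≤ d) (A : SL2R) (M N : PositiveMatrix d) :
    MapsSpinGon A (gon M hd) (gon N hd) ↔ N.1 = A.1 * M.1 := by
  have h : ∀ i, Maps (toSL2C A) ((gon M hd).decoration i) ((gon N hd).decoration i) ↔
      column N i = A.1.mulVec (column M i) := by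
    intro i
    refine (maps_iff (correspondsTo_decoration M hd i) (correspondsTo_decoration N hd i)).trans ?_
    rw [toSL2C_mulVec]
    exact realSpinor_injective.eq_iff
  simp only [MapsSpinGon, h]
  constructor
  · intro h
    ext k i
    exact congrFun (h i) k
  · intro h i
    ext k
    exact congrFun (congrFun h k) i

/-- Matrices with the same maximal minors lie in one orbit. -/
theorem exists_eq_mul_of_realDet_eq (hd : 2 ≤ d) {M N : PositiveMatrix d}
    (h : ∀ i j, realDet (column M i) (column M j) = realDet (column N i) (column N j)) :
    ∃ A : SL2R, N.1 = A.1 * M.1 := by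
  let a : Fin d := ⟨0, by omega⟩
  let b : Fin d := ⟨1, by omega⟩
  have hab : a < b := Nat.zero_lt_one
  set D := realDet (column M a) (column M b) with hD
  have hD0 : D ≠ 0 := (realDet_column_pos M hab).ne'
  have eM : M.1 0 a * M.1 1 b - M.1 1 a * M.1 0 b = D := rfl
  have eN : N.1 0 a * N.1 1 b - N.1 1 a * N.1 0 b = D := (h a b).symm
  -- This is the matrix with columns `N_a, N_b` times the inverse of the one with columns `M_a,
  -- M_b`; both have determinant `D`, so it has determinant 1.
  refine ⟨⟨!![(N.1 0 a * M.1 1 b - N.1 0 b * M.1 1 a) / D,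
      (N.1 0 b * M.1 0 a - N.1 0 a * M.1 0 b) / D;
      (N.1 1 a * M.1 1 b - N.1 1 b * M.1 1 a) / D,
      (N.1 1 b * M.1 0 a - N.1 1 a * M.1 0 b) / D], ?_⟩, ?_⟩
  · rw [Matrix.det_fin_two_of]
    field_simp
    linear_combination D * eN + (N.1 0 a * N.1 1 b - N.1 1 a * N.1 0 b) * eM
  · ext k i
    -- By Cramer's rule the minors with `a` and `b` are the coordinates of column `i` in the basis
    -- of columns `a, b`, and they agree for `M` and `N`.
    have ha := h a i
    have hb := h b i
    simp only [realDet, column] at ha hb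
    fin_cases k <;> simp [Matrix.mul_apply, Fin.sum_univ_two] <;> field_simp
    · linear_combination N.1 0 a * hb - N.1 0 b * ha - N.1 0 i * eN
    · linear_combination N.1 1 a * hb - N.1 1 b * ha - N.1 1 i * eN

end PositiveMatrix

/-! ### Comparison of isometry classes -/

/-- Isometric spin-coherent polygons lie in one orbit of spin isometries. -/
theorem exists_eq_mul_of_isometric {d : ℕ} (hd : 2 ≤ d) {M N : PositiveMatrix d}
    {φ : UpperHalfPlane ≃ᵢ UpperHalfPlane}
    (h : MapsGon φ (M.gon hd).toDecoratedIdealGon (N.gon hd).toDecoratedIdealGon) :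
    ∃ A : SL2R, N.1 = A.1 * M.1 := by
  have hlt : ∀ i j, i < j → realDet (M.column i) (M.column j) =
      realDet (N.column i) (N.column j) := by
    intro i j hij
    have hsq := realDet_sq_eq_of_isometry (M.column_ne_zero hd i) (M.column_ne_zero hd j)
      (N.column_ne_zero hd i) (N.column_ne_zero hd j) φ (h i) (h j)
    -- Both minors are positive, so equality of squares is equality.
    exact (pow_left_inj₀ (M.realDet_column_pos hij).le (N.realDet_column_pos hij).le
      two_ne_zero).mp hsq
  apply PositiveMatrix.exists_eq_mul_of_realDet_eq hd
  intro i j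
  rcases lt_trichotomy i j with hij | rfl | hij
  · exact hlt i j hij
  · simp only [realDet]; ring
  · rw [realDet_swap, hlt j i hij, ← realDet_swap]

/-- Each decorated ideal polygon underlies a spin-coherent one. -/
theorem exists_gon_eq {d : ℕ} (hd : 2 ≤ d) (P : DecoratedIdealGon d) :
    ∃ M : PositiveMatrix d, (M.gon hd).toDecoratedIdealGon = P := by
  choose r hr hc using P.isHorocycle
  choose v hv hp hs using fun i => exists_idealPoint_eq (P.vertex i) (hr i)
  let a : Fin d := ⟨0, by omega⟩
  -- A horocycle fixes its vector up to sign. Each sign is chosen to make the determinant with the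
  -- first vector positive.
  let w : Fin d → Fin 2 → ℝ := fun i => if i = a ∨ 0 < realDet (v a) (v i) then v i else -v i
  have hw : ∀ i, w i ≠ 0 ∧ idealPoint (w i) = P.vertex i ∧ horocycleSize (w i) = r i := by
    intro i
    by_cases h : i = a ∨ 0 < realDet (v a) (v i)
    · simp only [w, if_pos h]
      exact ⟨hv i, hp i, hs i⟩
    · simp only [w, if_neg h, ← hp i, ← hs i]
      refine ⟨neg_ne_zero.mpr (hv i), ?_, ?_⟩
      · simp [idealPoint]
      · simp [horocycleSize]
  have hwa : w a = v a := by simp [w]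
  have hpa : ∀ i, a < i → 0 < realDet (w a) (w i) := by
    intro i hi
    have hne : realDet (v a) (v i) ≠ 0 := by
      intro h0
      have := (realDet_eq_zero_iff (hv a) (hv i)).mp h0
      rw [hp, hp] at this
      exact hi.ne (P.inOrder.1 this)
    rw [hwa]
    by_cases h : 0 < realDet (v a) (v i)
    · simp only [w, if_pos (Or.inr h)]
      exact h
    · simp only [w, if_neg (not_or.mpr ⟨hi.ne', h⟩)]
      have : realDet (v a) (-v i) = -realDet (v a) (v i) := by simp [realDet]; ring
      rw [this]
      have := lt_of_le_of_ne (not_lt.mp h) hne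
      linarith
  have hpos : ∀ i j, i < j → 0 < realDet (w i) (w j) := by
    intro i j hij
    by_cases hi : i = a
    · subst hi; exact hpa j hij
    · have hai : a < i := lt_of_le_of_ne (Nat.zero_le _) (Ne.symm hi)
      -- Cyclic order makes the product of the three determinants positive. The two that involve `a`
      -- are positive already, so the third is too.
      have hcyc := P.inOrder.2 a i j hai hij
      rw [← (hw a).2.1, ← (hw i).2.1, ← (hw j).2.1,
        cyclicTriple_idealPoint_iff (hw a).1 (hw i).1 (hw j).1] at hcyc
      exact (mul_pos_iff_of_pos_left (hpa i hai)).mp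
        ((mul_pos_iff_of_pos_right (hpa j (hai.trans hij))).mp hcyc)
  refine ⟨PositiveMatrix.ofColumns w hpos, ?_⟩
  have hhor : ∀ i, plane ⁻¹' horosphere (spinorNormal (realSpinor (w i))) = P.horocycle i := by
    intro i
    rw [plane_preimage_horosphere, (hw i).2.1, (hw i).2.2, hc]
  obtain ⟨p, _, c, _⟩ := P
  simp only [PositiveMatrix.gon, DecoratedIdealGon.mk.injEq]
  exact ⟨funext fun i => (hw i).2.1, funext hhor⟩

theorem isometric_of_eq_mul {d : ℕ} (hd : 2 ≤ d) {M N : PositiveMatrix d} {A : SL2R}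
    (h : N.1 = A.1 * M.1) :
    MapsGon (IsometryEquiv.constSMul A) (M.gon hd).toDecoratedIdealGon
      (N.gon hd).toDecoratedIdealGon := fun i =>
  exists_isometry_maps (by
    ext k
    exact (congrFun (congrFun h k) i).symm)

/-- Positive matrices and spin-coherent polygons. -/
def gonEquiv {d : ℕ} (hd : 2 ≤ d) : PositiveMatrix d ≃ SpinCoherentGon d :=
  Equiv.ofBijective (fun M => M.gon hd)
    ⟨PositiveMatrix.gon_injective hd, PositiveMatrix.gon_surjective hd⟩

/-- Forgetting the spin decorations, on classes. -/
def forgetClass {d : ℕ} (hd : 2 ≤ d) : SpinIsometryClass d → IsometryClass d :=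
  Quotient.map SpinCoherentGon.toDecoratedIdealGon (by
    rintro X Y ⟨A, h⟩
    obtain ⟨M, rfl⟩ := PositiveMatrix.gon_surjective hd X
    obtain ⟨N, rfl⟩ := PositiveMatrix.gon_surjective hd Y
    exact ⟨_, isometric_of_eq_mul hd ((PositiveMatrix.mapsSpinGon_gon_iff hd A M N).mp h)⟩)

theorem forgetClass_bijective {d : ℕ} (hd : 2 ≤ d) : Function.Bijective (forgetClass hd) := by
  constructor
  · intro x y
    induction x using Quotient.inductionOn with | h X => ?_
    induction y using Quotient.inductionOn with | h Y => ?_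
    intro h
    obtain ⟨M, rfl⟩ := PositiveMatrix.gon_surjective hd X
    obtain ⟨N, rfl⟩ := PositiveMatrix.gon_surjective hd Y
    obtain ⟨φ, hφ⟩ := Quotient.exact h
    obtain ⟨A, hA⟩ := exists_eq_mul_of_isometric hd hφ
    exact Quotient.sound ⟨A, (PositiveMatrix.mapsSpinGon_gon_iff hd A M N).mpr hA⟩
  · intro y
    induction y using Quotient.inductionOn with | h P => ?_
    obtain ⟨M, rfl⟩ := exists_gon_eq hd P
    exact ⟨Quotient.mk _ (M.gon hd), rfl⟩

end SpinPolygon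

end

theorem mainTheorem11 (d : ℕ) (hd : 3 ≤ d) :
    ∃ (K : SpinPolygon.PositiveMatrix d ≃ SpinPolygon.SpinCoherentGon d)
      (Kbar : SpinPolygon.MatrixOrbit d ≃ SpinPolygon.SpinIsometryClass d)
      (Φ : SpinPolygon.SpinIsometryClass d ≃ SpinPolygon.IsometryClass d)
      (Ψ : SpinPolygon.MatrixOrbit d ≃ SpinPolygon.IsometryClass d),
      (∀ M i, SpinPolygon.CorrespondsTo ((K M).decoration i) (M.spinor i)) ∧
      (∀ (A : SpinPolygon.SL2R) (M N : SpinPolygon.PositiveMatrix d),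
        N.1 = A.1 * M.1 ↔ SpinPolygon.MapsSpinGon A (K M) (K N)) ∧
      (∀ M : SpinPolygon.PositiveMatrix d,
        Kbar (Quotient.mk (SpinPolygon.orbitSetoid d) M) =
          Quotient.mk (SpinPolygon.spinIsometrySetoid d) (K M)) ∧
      (∀ X : SpinPolygon.SpinCoherentGon d,
        Φ (Quotient.mk (SpinPolygon.spinIsometrySetoid d) X) =
          Quotient.mk (SpinPolygon.isometrySetoid d) X.toDecoratedIdealGon) ∧
      (∀ M : SpinPolygon.PositiveMatrix d,
        Ψ (Quotient.mk (SpinPolygon.orbitSetoid d) M) =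
          Quotient.mk (SpinPolygon.isometrySetoid d) (K M).toDecoratedIdealGon) := by
  have hd' : 2 ≤ d := by omega
  let K := SpinPolygon.gonEquiv hd'
  let Kbar : SpinPolygon.MatrixOrbit d ≃ SpinPolygon.SpinIsometryClass d :=
    -- Equivariance of `K` makes the two orbit relations correspond, with the same group element.
    Quotient.congr K fun M N => exists_congr fun A =>
      (SpinPolygon.PositiveMatrix.mapsSpinGon_gon_iff hd' A M N).symm
  let Φ := Equiv.ofBijective _ (SpinPolygon.forgetClass_bijective hd')
  exact ⟨K, Kbar, Φ, Kbar.trans Φ,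
    fun M i => SpinPolygon.PositiveMatrix.correspondsTo_decoration M hd' i,
    fun A M N => (SpinPolygon.PositiveMatrix.mapsSpinGon_gon_iff hd' A M N).symm,
    fun M => rfl, fun X => rfl, fun M => rfl⟩
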